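/- Let $d\ge 3$ and let $V:\mathbb R\to\mathbb R$ be twice differentiable with $\sup_t V''(t)\le 1$, $V(t)>0$ for all sufficiently large $|t|$, and $\liminf_{|t|\to\infty}\frac{\log V(t)}{\log|t|}>1$. For finite $\Lambda\subset\mathbb Z^d$, $\eta\in\mathbb R^{\mathbb Z^d}$ and $\varepsilon\ge 0$ let $$\mu_{\varepsilon,\Lambda}[\eta](d\varphi)=\frac1{Z_{\varepsilon,\Lambda}[\eta]}\exp\Bigl(-\tfrac1{4d}\sum_{\langle i,j\rangle\subset\Lambda}V(\varphi_i-\varphi_j)-\tfrac1{4d}\sum_{i\in\Lambda,\,j\notin\Lambda,\,|i-j|=1}V(\varphi_i)+\sum_{i\in\Lambda}\eta_i\varphi_i\Bigr)\prod_{i\in\Lambda}\bigl(d\varphi_i+\varepsilon\,\delta_0(d\varphi_i)\bigr)$$ where $Z_{\varepsilon,\Lambda}[\eta]$ is the normalization and the first sum runs over unordered pairs of nearest neighbours in $\Lambda$ (if $V$ is not even, $V(\varphi_i-\varphi_j)$ is to be read there as $\frac12(V(\varphi_i-\varphi_j)+V(\varphi_j-\varphi_i))$). Let $\Lambda_L=\{-L,\dots,L\}^d$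 and let $(\Delta g)(x)=\frac1{4d}\sum_{|y-x|=1}(g(y)-g(x))$ be the lattice Laplacian on $\mathbb Z^d$, normalized so that for $V(t)=t^2/2$ and $\eta=0$ the exponent above is $-\frac12\sum_{i\in\Lambda}\varphi_i(-\Delta\varphi)_i$ (with $\varphi=0$ off $\Lambda$). Then all $\mu_{\varepsilon,\Lambda_L}[\eta]$ are well-defined probability measures with integrable $\varphi_i$, $i\in\Lambda_L$; there is a unique function $g$ on $\mathbb Z^d$ with $-\Delta g=\delta_0$ that vanishes at infinity, and $(-\Delta^{-1})_{0,0}:=g(0)>0$. Moreover, there are constants $B_1,B_2\in(0,\infty)$, depending only on $d$ and $V$, such that for every $\varepsilon\ge0$ and all i.i.d. symmetrically distributed real random variables $(\eta_i)_{i\in\mathbb Z^d}$ with finite second moment, the overlap $\sum_{i\in\Lambda_L}\eta_i\,\mu_{\varepsilon,\Lambda_L}[\eta](\varphi_i)$ is a random variable with integrable negative part for every $L$, and $$\liminf_{L\to\infty}\frac1{L^d}\,\mathbb E\Bigl(\sum_{i\in\Lambda_L}\eta_i\,\mu_{\varepsilon,\Lambda_L}[\eta](\varphi_i)\Bigr)\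 \ge\ \frac{\mathbb E(\eta_0^2)\,(-\Delta^{-1})_{0,0}}2-\log(B_1+B_2\varepsilon),$$ where the expectation takes values in $(-\infty,\infty]$; if, for all large $L$, the variables $\eta_i\,\mu_{\varepsilon,\Lambda_L}[\eta](\varphi_i)$, $i\in\Lambda_L$, are integrable, the same bound holds for $\frac1{L^d}\sum_{i\in\Lambda_L}\mathbb E\bigl(\eta_i\,\mu_{\varepsilon,\Lambda_L}[\eta](\varphi_i)\bigr)$. -/

import Mathlib

open MeasureTheory ProbabilityTheory Filter Topology
open scoped NNReal ENNReal

noncomputable section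

namespace PinnedInterface

/-- The sites of the lattice `ℤ^d`. -/
abbrev Site (d : ℕ) : Type := Fin d → ℤ

/-- The nearest neighbours of the site `i`, that is, all `j` with `|i - j| = 1`
(see `mem_neighbours`; the interval only serves to exhibit finiteness). -/
def neighbours {d : ℕ} (i : Site d) : Finset (Site d) :=
  {j ∈ Finset.Icc (i - 1) (i + 1) | ∑ k, |i k - j k| = 1}

theorem mem_neighbours {d : ℕ} (i j : Site d) :
    j ∈ neighbours i ↔ ∑ k, |i k - j k| = 1 := by
  simp only [neighbours, Finset.mem_filter, Finset.mem_Icc, and_iff_right_iff_imp]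
  intro h
  have key : ∀ k, |i k - j k| ≤ 1 := fun k =>
    h ▸ Finset.single_le_sum (f := fun k => |i k - j k|) (fun _ _ => abs_nonneg _)
      (Finset.mem_univ k)
  constructor <;> intro k <;> have := abs_le.mp (key k) <;> simp <;> lia

/-- The cube `Λ_L = {-L, …, L}^d` of side length `2 L + 1` centred at the origin. -/
def box (d L : ℕ) : Finset (Site d) :=
  Finset.Icc (fun _ => -(L : ℤ)) (fun _ => (L : ℤ))

/-- Extension of a configuration on `Λ` by the boundary condition zero. -/
def zeroExtend {d : ℕ} {Λ : Finset (Site d)} (φ : Λ → ℝ) (i : Site d) : ℝ :=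
  if h : i ∈ Λ then φ ⟨i, h⟩ else 0

/-- The energy of a configuration `φ` in `Λ` with zero boundary condition and external field `η`.
The first sum runs over ordered pairs and carries the factor `1 / 2`: for an even `V` every
unordered pair `⟨i, j⟩` of neighbours in `Λ` is counted exactly once. -/
def energy {d : ℕ} (V : ℝ → ℝ) (Λ : Finset (Site d)) (η : Site d → ℝ) (φ : Λ → ℝ) : ℝ :=
  1 / (4 * d) * (1 / 2 * ∑ i ∈ Λ, ∑ j ∈ neighbours i with j ∈ Λ, V (zeroExtend φ i - zeroExtend φ j))
    + 1 / (4 * d) * (∑ i ∈ Λ, ∑ j ∈ neighbours i with j ∉ Λ, V (zeroExtend φ i))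
    - ∑ i ∈ Λ, η i * zeroExtend φ i

/-- The reference measure `∏_{i ∈ Λ} (dφ_i + ε δ_0(dφ_i))`. -/
def refMeasure {d : ℕ} (ε : ℝ≥0) (Λ : Finset (Site d)) : Measure (Λ → ℝ) :=
  Measure.pi fun _ => (volume + (ε : ℝ≥0∞) • Measure.dirac 0)

/-- The quenched finite-volume Gibbs measure with pinning strength `ε`: the measure with density
`exp (- energy) / Z` with respect to the reference measure, where `Z` is the integral of
`exp (- energy)`. -/
def gibbs {d : ℕ} (V : ℝ → ℝ) (ε : ℝ≥0) (Λ : Finset (Site d)) (η : Site d → ℝ) :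
    Measure (Λ → ℝ) :=
  (refMeasure ε Λ).tilted fun φ => - energy V Λ η φ

/-- The local magnetization: the Gibbs expectation of `φ_i`. -/
def magnetization {d : ℕ} (V : ℝ → ℝ) (ε : ℝ≥0) (Λ : Finset (Site d)) (η : Site d → ℝ)
    (i : Site d) : ℝ :=
  ∫ φ, zeroExtend φ i ∂(gibbs V ε Λ η)

/-- The overlap in `Λ` between the local magnetizations and the external field. -/
def overlap {d : ℕ} (V : ℝ → ℝ) (ε : ℝ≥0) (Λ : Finset (Site d)) (η : Site d → ℝ) : ℝ :=
  ∑ i ∈ Λ, η i * magnetization V ε Λ η i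

/-- The conditions on the potential: twice differentiable, `sup V'' ≤ 1`, and
`liminf_{|t| → ∞} log V(t) / log |t| > 1` (which presupposes that `V` is positive
near infinity). -/
structure IsAdmissible (V : ℝ → ℝ) : Prop where
  differentiable : Differentiable ℝ V
  differentiable_deriv : Differentiable ℝ (deriv V)
  deriv_deriv_le : ∀ t, deriv (deriv V) t ≤ 1
  eventually_pos : ∀ᶠ t in cocompact ℝ, 0 < V t
  growth : 1 < liminf (fun t : ℝ => ((Real.log (V t) / Real.log |t| : ℝ) : EReal)) (cocompact ℝ)

/-- The random fields are i.i.d., symmetrically distributed, with finite second moment. -/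
structure IsSymmetricIID {d : ℕ} {Ω : Type*} [MeasurableSpace Ω] (P : Measure Ω)
    (η : Site d → Ω → ℝ) : Prop where
  indep : iIndepFun η P
  identDistrib : ∀ i, IdentDistrib (η i) (η 0) P P
  symmetric : IdentDistrib (η 0) (- η 0) P P
  memLp : MemLp (η 0) 2 P

/-- The lattice Laplacian on `ℤ^d`, normalized as in the Gaussian model: for `V t = t ^ 2 / 2` and
`η = 0` the energy is `1 / 2 * ∑ i ∈ Λ, φ i * (-Δ φ) i`. -/
def laplacian {d : ℕ} (g : Site d → ℝ) (x : Site d) : ℝ :=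
  1 / (4 * d) * ∑ y ∈ neighbours x, (g y - g x)

/-- `g` is the column `((-Δ)⁻¹)_{·,0}` of the inverse of the infinite-volume lattice Laplacian:
the solution of `-Δ g = δ_0` that vanishes at infinity. -/
def IsGreenFunction {d : ℕ} (g : Site d → ℝ) : Prop :=
  (∀ x, - laplacian g x = if x = 0 then 1 else 0) ∧ Tendsto g cofinite (𝓝 0)

/-- The expectation of a random variable whose negative part is integrable, as an element of
`(-∞, ∞]`. -/
def extExpectation {Ω : Type*} [MeasurableSpace Ω] (P : Measure Ω) (X : Ω → ℝ) : EReal :=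
  ((∫⁻ ω, ENNReal.ofReal (X ω) ∂P : ℝ≥0∞) : EReal)
    - ((∫⁻ ω, ENNReal.ofReal (- X ω) ∂P : ℝ≥0∞) : EReal)

end PinnedInterface

end

open PinnedInterface

namespace PinnedInterface

/-! ### Nearest neighbours -/

theorem mem_neighbours_comm {d : ℕ} {i j : Site d} : j ∈ neighbours i ↔ i ∈ neighbours j := by
  simp only [mem_neighbours, abs_sub_comm]

theorem mem_neighbours_iff_exists {d : ℕ} {x y : Site d} :
    y ∈ neighbours x ↔ ∃ k, y = x + Pi.single k 1 ∨ y = x - Pi.single k 1 := by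
  rw [mem_neighbours]
  constructor
  · intro h
    have hne : ∃ k, x k - y k ≠ 0 := by
      by_contra! hc
      simp [hc] at h
    obtain ⟨k, hk⟩ := hne
    have hk1 : 1 ≤ |x k - y k| := Int.one_le_abs hk
    have hsplit := Finset.add_sum_erase Finset.univ (fun l => |x l - y l|) (Finset.mem_univ k)
    have hnn : 0 ≤ ∑ l ∈ Finset.univ.erase k, |x l - y l| :=
      Finset.sum_nonneg fun _ _ => abs_nonneg _
    have hz : ∑ l ∈ Finset.univ.erase k, |x l - y l| = 0 := by omega
    have hke : |x k - y k| = 1 := by omega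
    have hl : ∀ l, l ≠ k → y l = x l := by
      intro l hlk
      have := (Finset.sum_eq_zero_iff_of_nonneg (fun _ _ => abs_nonneg _)).1 hz l
        (Finset.mem_erase.2 ⟨hlk, Finset.mem_univ _⟩)
      rw [abs_eq_zero] at this
      omega
    refine ⟨k, ?_⟩
    rcases (abs_eq (by norm_num)).1 hke with h1 | h1
    · right
      ext l
      by_cases hlk : l = k
      · subst hlk; simp; omega
      · simp [hlk, hl l hlk]
    · left
      ext l
      by_cases hlk : l = k
      · subst hlk; simp; omega
      · simp [hlk, hl l hlk]
  · rintro ⟨k, rfl | rfl⟩ <;>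
    · simp only [Pi.add_apply, Pi.sub_apply, sub_add_cancel_left, sub_sub_cancel, abs_neg]
      rw [Finset.sum_eq_single k]
      · simp
      · intro b _ hb; simp [hb]
      · simp

theorem sum_neighbours {d : ℕ} {M : Type*} [AddCommMonoid M] (x : Site d) (F : Site d → M) :
    ∑ y ∈ neighbours x, F y = ∑ k, (F (x + Pi.single k 1) + F (x - Pi.single k 1)) := by
  classical
  have himg : neighbours x = (Finset.univ.image fun k : Fin d => x + Pi.single k (1 : ℤ)) ∪
      (Finset.univ.image fun k : Fin d => x - Pi.single k (1 : ℤ)) := by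
    ext y
    simp only [mem_neighbours_iff_exists, Finset.mem_union, Finset.mem_image, Finset.mem_univ,
      true_and, ← exists_or, eq_comm]
  have hinj : Function.Injective fun k : Fin d => (Pi.single k (1 : ℤ) : Site d) := by
    intro k l h
    by_contra hkl
    have := congrFun h k
    simp [hkl] at this
  have hdisj : Disjoint (Finset.univ.image fun k : Fin d => x + Pi.single k (1 : ℤ))
      (Finset.univ.image fun k : Fin d => x - Pi.single k (1 : ℤ)) := by
    rw [Finset.disjoint_left]
    intro y hy hy'
    obtain ⟨k, -, rfl⟩ := Finset.mem_image.1 hy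
    obtain ⟨l, -, hl⟩ := Finset.mem_image.1 hy'
    have := congrFun hl k
    by_cases hkl : k = l
    · subst hkl; simp at this; omega
    · simp [hkl] at this
  rw [himg, Finset.sum_union hdisj, Finset.sum_image fun a _ b _ h => hinj (add_left_cancel h),
    Finset.sum_image fun a _ b _ h => hinj (sub_right_injective h), Finset.sum_add_distrib]

theorem card_neighbours {d : ℕ} (x : Site d) : (neighbours x).card = 2 * d := by
  rw [Finset.card_eq_sum_ones, sum_neighbours]
  simp [mul_comm]

/-! ### Maximum principle -/

theorem tendsto_add_nsmul_cofinite {d : ℕ} (x : Site d) (k : Fin d) :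
    Tendsto (fun n : ℕ => x + n • (Pi.single k 1 : Site d)) atTop cofinite := by
  rw [← Nat.cofinite_eq_atTop]
  apply Function.Injective.tendsto_cofinite
  intro m n h
  have := congrFun h k
  simpa using this

/-- A superharmonic function that vanishes at infinity is nonnegative. -/
theorem nonneg_of_laplacian_nonpos {d : ℕ} (hd : 0 < d) {u : Site d → ℝ}
    (hu : ∀ x, laplacian u x ≤ 0) (h0 : Tendsto u cofinite (𝓝 0)) (x : Site d) : 0 ≤ u x := by
  by_contra! hx
  have hfin : {y | ¬ (u x < u y)}.Finite := h0.eventually (lt_mem_nhds hx)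
  obtain ⟨z, hz, hmin⟩ := hfin.toFinset.exists_min_image u ⟨x, by simp⟩
  have hzx : u z ≤ u x := by simpa using hz
  have hglob : ∀ y, u z ≤ u y := by
    intro y
    by_cases hy : u x < u y
    · linarith
    · exact hmin y (by simpa using hy)
  have hprop : ∀ y, u y = u z → ∀ w ∈ neighbours y, u w = u z := by
    intro y hy w hw
    have h1 : ∑ w ∈ neighbours y, (u w - u y) ≤ 0 := by
      have h := hu y
      unfold laplacian at h
      have hpos : (0 : ℝ) < 1 / (4 * d) := by positivity
      by_contra! hc
      have := mul_pos hpos hc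
      linarith
    have h2 : ∀ w ∈ neighbours y, 0 ≤ u w - u y := fun w _ => by rw [hy]; linarith [hglob w]
    have h3 := (Finset.sum_eq_zero_iff_of_nonneg h2).1 (le_antisymm h1 (Finset.sum_nonneg h2)) w hw
    linarith
  let k : Fin d := ⟨0, hd⟩
  have hline : ∀ n : ℕ, u (z + n • (Pi.single k 1 : Site d)) = u z := by
    intro n
    induction n with
    | zero => simp
    | succ n ih =>
      refine hprop _ ih _ (mem_neighbours_iff_exists.2 ⟨k, Or.inl ?_⟩)
      rw [succ_nsmul, add_assoc]
  have hlim := h0.comp (tendsto_add_nsmul_cofinite z k)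
  have : Tendsto (fun _ : ℕ => u z) atTop (𝓝 0) := by
    refine hlim.congr fun n => ?_
    simp [← hline n]
  have := tendsto_nhds_unique this tendsto_const_nhds
  linarith

theorem laplacian_sub {d : ℕ} (g h : Site d → ℝ) (x : Site d) :
    laplacian (g - h) x = laplacian g x - laplacian h x := by
  simp only [laplacian, ← mul_sub, ← Finset.sum_sub_distrib, Pi.sub_apply]
  congr 1
  exact Finset.sum_congr rfl fun _ _ => by ring

theorem IsGreenFunction.nonneg {d : ℕ} (hd : 0 < d) {g : Site d → ℝ} (hg : IsGreenFunction g)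
    (x : Site d) : 0 ≤ g x := by
  refine nonneg_of_laplacian_nonpos hd (fun x => ?_) hg.2 x
  have := hg.1 x
  split_ifs at this <;> linarith

theorem IsGreenFunction.le {d : ℕ} (hd : 0 < d) {g h : Site d → ℝ} (hg : IsGreenFunction g)
    (hh : IsGreenFunction h) (x : Site d) : g x ≤ h x := by
  have := nonneg_of_laplacian_nonpos hd (u := h - g)
    (fun x => by have h1 := hg.1 x; have h2 := hh.1 x; rw [laplacian_sub]; linarith)
    (by rw [← sub_zero (0 : ℝ)]; exact hh.2.sub hg.2) x
  simpa using this

theorem IsGreenFunction.unique {d : ℕ} (hd : 0 < d) {g h : Site d → ℝ} (hg : IsGreenFunction g)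
    (hh : IsGreenFunction h) : g = h :=
  funext fun x => le_antisymm (hg.le hd hh x) (hh.le hd hg x)

theorem IsGreenFunction.pos {d : ℕ} (hd : 0 < d) {g : Site d → ℝ} (hg : IsGreenFunction g) :
    0 < g 0 := by
  refine lt_of_le_of_ne (hg.nonneg hd 0) fun h0 => ?_
  have h := hg.1 0
  have : 0 ≤ laplacian g 0 :=
    mul_nonneg (by positivity)
      (Finset.sum_nonneg fun y _ => by have := hg.nonneg hd y; linarith)
  simp at h
  linarith

/-! ### Existence of the Green function in dimension at least three -/

/-- Lebesgue measure on the centred unit cube, the space of lattice momenta. -/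
noncomputable def momentumMeasure (d : ℕ) : Measure (Fin d → ℝ) :=
  Measure.pi fun _ => volume.restrict (Set.Icc (-1 / 2) (1 / 2))

instance (d : ℕ) : IsFiniteMeasure (momentumMeasure d) := by
  unfold momentumMeasure; infer_instance

theorem momentumMeasure_eq_restrict (d : ℕ) :
    momentumMeasure d = volume.restrict (Set.univ.pi fun _ => Set.Icc (-1 / 2) (1 / 2)) := by
  rw [volume_pi, Measure.restrict_pi_pi, momentumMeasure]

/-- The Fourier multiplier of `-Δ`. -/
noncomputable def symbol (d : ℕ) (v : Fin d → ℝ) : ℝ :=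
  1 / (2 * d) * ∑ k, (1 - Real.cos (2 * Real.pi * v k))

theorem continuous_symbol (d : ℕ) : Continuous (symbol d) := by
  unfold symbol; fun_prop

theorem ae_mem_cube (d : ℕ) : ∀ᵐ v ∂momentumMeasure d, ∀ k, v k ∈ Set.Icc (-1 / 2 : ℝ) (1 / 2) := by
  rw [momentumMeasure_eq_restrict]
  filter_upwards [ae_restrict_mem (MeasurableSet.univ_pi fun _ => measurableSet_Icc)] with v hv k
  exact hv k trivial

theorem ae_coord_ne_zero (d : ℕ) : ∀ᵐ v ∂momentumMeasure d, ∀ k, v k ≠ 0 := by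
  rw [ae_all_iff]
  intro k
  exact Measure.ae_eval_ne (μ := fun _ : Fin d => volume.restrict (Set.Icc (-1 / 2 : ℝ) (1 / 2))) k 0

theorem le_symbol {d : ℕ} (hd : 0 < d) {v : Fin d → ℝ}
    (hv : ∀ k, v k ∈ Set.Icc (-1 / 2 : ℝ) (1 / 2)) :
    4 * ∏ k, (v k ^ 2) ^ (1 / d : ℝ) ≤ symbol d v := by
  have hd' : (0 : ℝ) < d := by exact_mod_cast hd
  have h1 : ∏ k, (v k ^ 2) ^ (1 / d : ℝ) ≤ ∑ k, (1 / d : ℝ) * v k ^ 2 :=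
    Real.geom_mean_le_arith_mean_weighted Finset.univ (fun _ => (1 / d : ℝ)) (fun k => v k ^ 2)
      (fun _ _ => by positivity) (by simp [hd'.ne']) (fun _ _ => sq_nonneg _)
  have h2 : ∀ k, 8 * v k ^ 2 ≤ 1 - Real.cos (2 * Real.pi * v k) := by
    intro k
    have hk := hv k
    have habs : |2 * Real.pi * v k| ≤ Real.pi := by
      rw [abs_le]
      constructor <;> nlinarith [Real.pi_pos, hk.1, hk.2]
    have := Real.cos_le_one_sub_mul_cos_sq habs
    have e : 2 / Real.pi ^ 2 * (2 * Real.pi * v k) ^ 2 = 8 * v k ^ 2 := by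
      field_simp; ring
    linarith
  calc 4 * ∏ k, (v k ^ 2) ^ (1 / d : ℝ) ≤ 4 * ∑ k, (1 / d : ℝ) * v k ^ 2 := by linarith
    _ = 1 / (2 * d) * ∑ k, 8 * v k ^ 2 := by
        rw [← Finset.mul_sum, ← Finset.mul_sum]; field_simp; ring
    _ ≤ symbol d v := by
        unfold symbol
        gcongr with k _
        exact h2 k

theorem integrableOn_inv_sq_rpow {r : ℝ} (h1 : r < 1 / 2) :
    IntegrableOn (fun t : ℝ => ((t ^ 2) ^ r)⁻¹) (Set.Icc (-1 / 2) (1 / 2)) := by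
  have hpos : IntegrableOn (fun t : ℝ => ((t ^ 2) ^ r)⁻¹) (Set.Icc 0 (1 / 2)) := by
    have h := intervalIntegral.intervalIntegrable_rpow' (a := 0) (b := 1 / 2) (r := -(2 * r))
      (by linarith)
    rw [intervalIntegrable_iff_integrableOn_Icc_of_le (by norm_num)] at h
    refine h.congr_fun (fun t ht => ?_) measurableSet_Icc
    simp only
    rw [Real.rpow_neg ht.1, Real.rpow_mul ht.1, Real.rpow_two]
  have hneg : IntegrableOn (fun t : ℝ => ((t ^ 2) ^ r)⁻¹) (Set.Icc (-1 / 2) 0) := by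
    have h := hpos.comp_neg
    simpa [neg_div] using h
  have := hneg.union hpos
  rwa [Set.Icc_union_Icc_eq_Icc (by norm_num) (by norm_num)] at this

theorem symbol_pos_ae {d : ℕ} (hd : 0 < d) : ∀ᵐ v ∂momentumMeasure d, 0 < symbol d v := by
  filter_upwards [ae_mem_cube d, ae_coord_ne_zero d] with v hv h0
  refine lt_of_lt_of_le ?_ (le_symbol hd hv)
  have : 0 < ∏ k, (v k ^ 2) ^ (1 / d : ℝ) := Finset.prod_pos fun k _ => by
    have := h0 k; positivity
  positivity

theorem integrable_inv_symbol {d : ℕ} (hd : 3 ≤ d) :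
    Integrable (fun v => (symbol d v)⁻¹) (momentumMeasure d) := by
  have hd' : (3 : ℝ) ≤ d := by exact_mod_cast hd
  have hr : (1 / d : ℝ) < 1 / 2 := one_div_lt_one_div_of_lt (by norm_num) (by linarith)
  have hprod : Integrable (fun v : Fin d → ℝ => ∏ k, ((v k ^ 2) ^ (1 / d : ℝ))⁻¹)
      (momentumMeasure d) :=
    Integrable.fintype_prod (f := fun _ t => ((t ^ 2) ^ (1 / d : ℝ))⁻¹)
      fun _ => integrableOn_inv_sq_rpow hr
  refine (hprod.const_mul (1 / 4)).mono'
    (continuous_symbol d).measurable.inv.aestronglyMeasurable ?_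
  filter_upwards [ae_mem_cube d, ae_coord_ne_zero d, symbol_pos_ae (by omega : 0 < d)]
    with v hv h0 hS
  rw [Real.norm_of_nonneg (by positivity), Finset.prod_inv_distrib]
  have hP : 0 < ∏ k, (v k ^ 2) ^ (1 / d : ℝ) := Finset.prod_pos fun k _ => by
    have := h0 k; positivity
  calc (symbol d v)⁻¹ ≤ (4 * ∏ k, (v k ^ 2) ^ (1 / d : ℝ))⁻¹ :=
        inv_anti₀ (by positivity) (le_symbol (by omega) hv)
    _ = _ := by rw [mul_inv]; norm_num

/-- The phase `x · v` of the plane wave with momentum `v`. -/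
noncomputable def phase {d : ℕ} (x : Site d) (v : Fin d → ℝ) : ℝ := ∑ k, (x k : ℝ) * v k

theorem continuous_phase {d : ℕ} (x : Site d) : Continuous (phase x) := by
  unfold phase; fun_prop

theorem integral_exp_int_mul (n : ℤ) :
    ∫ t in Set.Icc (-1 / 2 : ℝ) (1 / 2), Complex.exp (2 * Real.pi * Complex.I * n * t) =
      if n = 0 then 1 else 0 := by
  rw [integral_Icc_eq_integral_Ioc, ← intervalIntegral.integral_of_le (by norm_num)]
  split_ifs with h
  · subst h; norm_num
  · have hc : 2 * Real.pi * Complex.I * n ≠ 0 := by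
      simp [Real.pi_ne_zero, Complex.I_ne_zero, h]
    rw [integral_exp_mul_complex hc, div_eq_zero_iff]
    left
    rw [sub_eq_zero, Complex.exp_eq_exp_iff_exists_int]
    refine ⟨n, ?_⟩
    push_cast
    ring

theorem integral_cos_phase {d : ℕ} (x : Site d) :
    ∫ v, Real.cos (2 * Real.pi * phase x v) ∂momentumMeasure d = if x = 0 then 1 else 0 := by
  have hc : ∫ v, Complex.exp (2 * Real.pi * phase x v * Complex.I) ∂momentumMeasure d =
      if x = 0 then 1 else 0 := by
    have h := integral_fintype_prod_eq_prod (𝕜 := ℂ) (ι := Fin d) (E := fun _ => ℝ)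
      (fun k t => Complex.exp (2 * Real.pi * Complex.I * x k * t))
      (μ := fun _ => volume.restrict (Set.Icc (-1 / 2 : ℝ) (1 / 2)))
    simp_rw [integral_exp_int_mul] at h
    rw [Finset.prod_ite_zero] at h
    simp only [Finset.mem_univ, forall_const, Finset.prod_const_one] at h
    rw [momentumMeasure]
    simp only [funext_iff, Pi.zero_apply]
    rw [← h]
    congr 1
    ext v
    rw [← Complex.exp_sum]
    congr 1
    simp only [phase, Complex.ofReal_sum, Finset.mul_sum, Finset.sum_mul, Complex.ofReal_mul,
      Complex.ofReal_intCast]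
    exact Finset.sum_congr rfl fun _ _ => by ring
  have hint : Integrable (fun v => Complex.exp (2 * Real.pi * phase x v * Complex.I))
      (momentumMeasure d) := by
    refine Integrable.of_bound (C := 1) ?_ ?_
    · have := continuous_phase x
      exact Continuous.aestronglyMeasurable (by fun_prop)
    · refine Eventually.of_forall fun v => ?_
      rw [← Complex.ofReal_ofNat, ← Complex.ofReal_mul, ← Complex.ofReal_mul,
        Complex.norm_exp_ofReal_mul_I]
  have hre := congrArg Complex.re hc
  rw [← Complex.reCLM_apply, ← Complex.reCLM.integral_comp_comm hint] at hre
  simp only [Complex.reCLM_apply] at hre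
  convert hre using 1
  · congr 1
    ext v
    rw [← Complex.ofReal_ofNat, ← Complex.ofReal_mul, ← Complex.ofReal_mul,
      Complex.exp_ofReal_mul_I_re]
  · split_ifs <;> simp

/-- The Green function as a Fourier integral. -/
noncomputable def green (d : ℕ) (x : Site d) : ℝ :=
  ∫ v, Real.cos (2 * Real.pi * phase x v) * (symbol d v)⁻¹ ∂momentumMeasure d

theorem integrable_cos_mul_inv_symbol {d : ℕ} (hd : 3 ≤ d) (x : Site d) :
    Integrable (fun v => Real.cos (2 * Real.pi * phase x v) * (symbol d v)⁻¹)
      (momentumMeasure d) := by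
  refine (integrable_inv_symbol hd).bdd_mul (c := 1) ?_ ?_
  · have := continuous_phase x
    exact Continuous.aestronglyMeasurable (by fun_prop)
  · exact Eventually.of_forall fun v => Real.abs_cos_le_one _

theorem neg_laplacian_green {d : ℕ} (hd : 3 ≤ d) (x : Site d) :
    -laplacian (green d) x = if x = 0 then 1 else 0 := by
  have hint := integrable_cos_mul_inv_symbol hd
  rw [← integral_cos_phase x]
  unfold laplacian green
  simp_rw [← integral_sub (hint _) (hint x)]
  rw [← integral_finsetSum _ fun y _ => by exact (hint y).sub (hint x), ← integral_const_mul,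
    ← integral_neg]
  refine integral_congr_ae ?_
  filter_upwards [symbol_pos_ae (by omega : 0 < d)] with v hS
  have hphase : ∀ k : Fin d, phase (x + Pi.single k 1) v = phase x v + v k ∧
      phase (x - Pi.single k 1) v = phase x v - v k := by
    intro k
    simp [phase, add_mul, sub_mul, Finset.sum_add_distrib, Finset.sum_sub_distrib, Pi.single_apply]
  rw [sum_neighbours]
  have hterm : ∀ k : Fin d,
      (Real.cos (2 * Real.pi * phase (x + Pi.single k 1) v) * (symbol d v)⁻¹ -
        Real.cos (2 * Real.pi * phase x v) * (symbol d v)⁻¹ +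
      (Real.cos (2 * Real.pi * phase (x - Pi.single k 1) v) * (symbol d v)⁻¹ -
        Real.cos (2 * Real.pi * phase x v) * (symbol d v)⁻¹)) =
      -(2 * Real.cos (2 * Real.pi * phase x v) * (symbol d v)⁻¹) *
        (1 - Real.cos (2 * Real.pi * v k)) := by
    intro k
    rw [(hphase k).1, (hphase k).2, mul_add, mul_sub, Real.cos_add, Real.cos_sub]
    ring
  rw [Finset.sum_congr rfl fun k _ => hterm k, ← Finset.mul_sum]
  have hsum : ∑ k, (1 - Real.cos (2 * Real.pi * v k)) = 2 * d * symbol d v := by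
    have : (d : ℝ) ≠ 0 := by positivity
    unfold symbol; field_simp
  rw [hsum]
  have : (d : ℝ) ≠ 0 := by positivity
  field_simp
  ring

theorem tendsto_green {d : ℕ} (hd : 3 ≤ d) : Tendsto (green d) cofinite (𝓝 0) := by
  let w : Site d → StrongDual ℝ (Fin d → ℝ) := fun x =>
    ∑ k, (x k : ℝ) • ContinuousLinearMap.proj (R := ℝ) (φ := fun _ : Fin d => ℝ) k
  have hw : ∀ x v, w x v = phase x v := fun x v => by simp [w, phase]
  have hwt : Tendsto w cofinite (cocompact _) := by
    refine tendsto_cocompact_of_tendsto_dist_comp_atTop 0 ?_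
    rw [tendsto_atTop]
    intro c
    rw [eventually_cofinite]
    refine Set.Finite.subset (Set.finite_Icc (fun _ => -⌈c⌉) (fun _ => ⌈c⌉)) fun x hx => ?_
    simp only [dist_zero_right, not_le, Set.mem_ofPred_eq] at hx
    have key : ∀ k, |(x k : ℝ)| ≤ c := by
      intro k
      have h1 := (w x).le_opNorm (Pi.single k 1)
      rw [hw] at h1
      have h2 : phase x (Pi.single k 1) = x k := by simp [phase, Pi.single_apply]
      rw [h2] at h1
      have h3 : ‖(Pi.single k 1 : Fin d → ℝ)‖ = 1 := by
        rw [Pi.norm_single]; simp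
      rw [h3, mul_one, Real.norm_eq_abs] at h1
      linarith
    constructor <;> intro k <;> have h := abs_le.1 (key k)
    · have : -(x k) ≤ ⌈c⌉ := by
        have : (-(x k : ℝ)) ≤ ⌈c⌉ := by linarith [Int.le_ceil c]
        exact_mod_cast this
      simp only; omega
    · have : (x k : ℝ) ≤ ⌈c⌉ := by linarith [Int.le_ceil c]
      exact_mod_cast this
  let Q : Set (Fin d → ℝ) := Set.univ.pi fun _ => Set.Icc (-1 / 2) (1 / 2)
  have hQ : MeasurableSet Q := MeasurableSet.univ_pi fun _ => measurableSet_Icc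
  have hRL := (tendsto_integral_exp_smul_cocompact
    (Q.indicator fun v => (((symbol d v)⁻¹ : ℝ) : ℂ)) (volume : Measure (Fin d → ℝ))).comp hwt
  have hre := (Complex.continuous_re.tendsto 0).comp hRL
  refine hre.congr fun x => ?_
  have hind : ∀ v, Real.fourierChar (-w x v) •
      Q.indicator (fun v => (((symbol d v)⁻¹ : ℝ) : ℂ)) v =
      Q.indicator (fun v => (Real.fourierChar (-w x v) : ℂ) * (((symbol d v)⁻¹ : ℝ) : ℂ)) v := by
    intro v
    by_cases hv : v ∈ Q <;> simp [hv, Circle.smul_def]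
  have hint : Integrable
      (fun v => (Real.fourierChar (-w x v) : ℂ) * (((symbol d v)⁻¹ : ℝ) : ℂ))
      (momentumMeasure d) := by
    refine (integrable_inv_symbol hd).ofReal.bdd_mul (c := 1) ?_ ?_
    · have := Real.continuous_fourierChar
      exact Continuous.aestronglyMeasurable (by fun_prop)
    · exact Eventually.of_forall fun v => (Circle.norm_coe _).le
  simp only [Function.comp_apply, green]
  simp_rw [hind]
  rw [integral_indicator hQ, ← momentumMeasure_eq_restrict, ← Complex.reCLM_apply,
    ← Complex.reCLM.integral_comp_comm hint]
  congr 1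
  ext v
  rw [Complex.reCLM_apply, Complex.re_mul_ofReal, Real.fourierChar_apply, hw,
    Complex.exp_ofReal_mul_I_re, mul_neg, Real.cos_neg]

theorem isGreenFunction_green {d : ℕ} (hd : 3 ≤ d) : IsGreenFunction (green d) :=
  ⟨neg_laplacian_green hd, tendsto_green hd⟩

/-! ### Finitely supported approximations of the Green function -/

theorem mem_box {d L : ℕ} {i : Site d} : i ∈ box d L ↔ ∀ k, |i k| ≤ L := by
  simp only [box, Finset.mem_Icc, Pi.le_def, abs_le, forall_and]

theorem box_mono (d : ℕ) {L M : ℕ} (h : L ≤ M) : box d L ⊆ box d M := fun i hi => by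
  rw [mem_box] at hi ⊢
  exact fun k => (hi k).trans (by exact_mod_cast h)

theorem abs_sub_le_of_mem_neighbours {d : ℕ} {i j : Site d} (h : j ∈ neighbours i) (k : Fin d) :
    |i k - j k| ≤ 1 :=
  ((mem_neighbours i j).1 h) ▸ Finset.single_le_sum (f := fun k => |i k - j k|)
    (fun _ _ => abs_nonneg _) (Finset.mem_univ k)

theorem mem_box_succ_of_mem_neighbours {d R : ℕ} {i j : Site d} (hi : i ∈ box d R)
    (h : j ∈ neighbours i) : j ∈ box d (R + 1) := by
  rw [mem_box] at hi ⊢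
  intro k
  have h1 := abs_le.1 (hi k)
  have h2 := abs_le.1 (abs_sub_le_of_mem_neighbours h k)
  rw [abs_le]
  push_cast
  omega

theorem card_box (d L : ℕ) : (box d L).card = (2 * L + 1) ^ d := by
  rw [box, Pi.card_Icc]
  simp only [Int.card_Icc, Finset.prod_const, Finset.card_univ, Fintype.card_fin]
  congr 1
  omega

theorem exists_support_subset_box {d : ℕ} {s : Set (Site d)} (hs : s.Finite) :
    ∃ R, ∀ i ∈ s, i ∈ box d R := by
  refine ⟨∑ i ∈ hs.toFinset, ∑ k, (i k).natAbs, fun i hi => mem_box.2 fun k => ?_⟩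
  rw [Int.abs_eq_natAbs]
  norm_cast
  calc (i k).natAbs ≤ ∑ k, (i k).natAbs :=
        Finset.single_le_sum (f := fun k => (i k).natAbs) (fun _ _ => Nat.zero_le _)
          (Finset.mem_univ k)
    _ ≤ _ := Finset.single_le_sum (f := fun i : Site d => ∑ k, (i k).natAbs)
          (fun _ _ => Nat.zero_le _) (hs.mem_toFinset.2 hi)

theorem sum_neighbours_swap {d R : ℕ} {T : Finset (Site d)} (hT : box d (R + 1) ⊆ T)
    (F : Site d → Site d → ℝ) (hF : ∀ i j, i ∉ box d R → F i j = 0) :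
    ∑ i ∈ T, ∑ j ∈ neighbours i, F j i = ∑ i ∈ T, ∑ j ∈ neighbours i, F i j := by
  calc ∑ i ∈ T, ∑ j ∈ neighbours i, F j i
      = ∑ i ∈ T, ∑ j ∈ neighbours i with j ∈ T, F j i := by
        refine Finset.sum_congr rfl fun i _ => (Finset.sum_filter_of_ne fun j _ hne => ?_).symm
        by_contra hj
        exact hne (hF j i fun h => hj (hT (box_mono d (Nat.le_succ R) h)))
    _ = ∑ j ∈ T, ∑ i ∈ neighbours j with i ∈ T, F j i := by
        refine Finset.sum_comm' fun i j => ?_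
        simp only [Finset.mem_filter]
        rw [mem_neighbours_comm]
        tauto
    _ = ∑ i ∈ T, ∑ j ∈ neighbours i, F i j := by
        refine Finset.sum_congr rfl fun i _ => Finset.sum_filter_of_ne fun j hj hne => ?_
        by_contra hjT
        exact hne (hF i j fun h => hjT (hT (mem_box_succ_of_mem_neighbours h hj)))

/-- Truncating the Green function from below at height `δ` gives a finitely supported function
whose Dirichlet energy is at most its value at the origin. -/
theorem IsGreenFunction.exists_truncation {d : ℕ} (hd : 0 < d) {g : Site d → ℝ}
    (hg : IsGreenFunction g) {δ : ℝ} (hδ : 0 < δ) (hδg : δ < g 0) :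
    ∃ (R : ℕ) (f : Site d → ℝ), (∀ i, i ∉ box d R → f i = 0) ∧ f 0 = g 0 - δ ∧
      ∀ S : Finset (Site d), ∑ i ∈ S, ∑ j ∈ neighbours i, (f i - f j) ^ 2 ≤ 8 * d * f 0 := by
  let f : Site d → ℝ := fun i => max (g i - δ) 0
  have hfin : {i | ¬ (g i < δ)}.Finite := hg.2.eventually (gt_mem_nhds hδ)
  obtain ⟨R, hR⟩ := exists_support_subset_box hfin
  have hsupp : ∀ i, i ∉ box d R → f i = 0 := by
    intro i hi
    have : g i < δ := by
      by_contra h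
      exact hi (hR i h)
    exact max_eq_right (by linarith)
  refine ⟨R, f, hsupp, max_eq_left (by linarith), fun S => ?_⟩
  have hd' : (0 : ℝ) < d := by exact_mod_cast hd
  classical
  let T := S ∪ box d (R + 1)
  have hT : box d (R + 1) ⊆ T := Finset.subset_union_right
  have h0T : (0 : Site d) ∈ T := hT (mem_box.2 fun k => by simp; positivity)
  have hmono : ∀ i j, (f i - f j) ^ 2 ≤ (f i - f j) * (g i - g j) := by
    intro i j
    simp only [f]
    rcases max_cases (g i - δ) 0 with ⟨h1, h1'⟩ | ⟨h1, h1'⟩ <;>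
      rcases max_cases (g j - δ) 0 with ⟨h2, h2'⟩ | ⟨h2, h2'⟩ <;> rw [h1, h2] <;> nlinarith
  have hparts : ∑ i ∈ T, ∑ j ∈ neighbours i, f i * (g i - g j) = 4 * d * f 0 := by
    have : ∀ i, ∑ j ∈ neighbours i, f i * (g i - g j) = 4 * d * f i * if i = 0 then 1 else 0 := by
      intro i
      rw [← hg.1 i, laplacian, ← Finset.mul_sum]
      have : ∑ j ∈ neighbours i, (g i - g j) = -∑ j ∈ neighbours i, (g j - g i) := by
        rw [← Finset.sum_neg_distrib]; simp
      rw [this]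
      field_simp
    rw [Finset.sum_congr rfl fun i _ => this i]
    simp [h0T]
  calc ∑ i ∈ S, ∑ j ∈ neighbours i, (f i - f j) ^ 2
      ≤ ∑ i ∈ T, ∑ j ∈ neighbours i, (f i - f j) ^ 2 :=
        Finset.sum_le_sum_of_subset_of_nonneg Finset.subset_union_left
          fun _ _ _ => Finset.sum_nonneg fun _ _ => sq_nonneg _
    _ ≤ ∑ i ∈ T, ∑ j ∈ neighbours i, (f i - f j) * (g i - g j) :=
        Finset.sum_le_sum fun i _ => Finset.sum_le_sum fun j _ => hmono i j
    _ = ∑ i ∈ T, ∑ j ∈ neighbours i, f i * (g i - g j) +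
        ∑ i ∈ T, ∑ j ∈ neighbours i, f j * (g j - g i) := by
        simp only [← Finset.sum_add_distrib]
        exact Finset.sum_congr rfl fun _ _ => Finset.sum_congr rfl fun _ _ => by ring
    _ = 8 * d * f 0 := by
        rw [sum_neighbours_swap hT (fun i j => f i * (g i - g j))
          (fun i j hi => by simp [hsupp i hi]), hparts]
        ring

/-! ### The potential -/

namespace IsAdmissible

variable {V : ℝ → ℝ}

theorem continuous (hV : IsAdmissible V) : Continuous V := hV.differentiable.continuous

theorem eventually_mul_abs_le (hV : IsAdmissible V) (K : ℝ) :
    ∀ᶠ t in cocompact ℝ, K * |t| ≤ V t := by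
  obtain ⟨α, hα1, hα⟩ := EReal.lt_iff_exists_real_btwn.1 hV.growth
  have hα1 : 1 < α := by exact_mod_cast hα1
  have habs : Tendsto (fun t : ℝ => |t|) (cocompact ℝ) atTop := tendsto_norm_cocompact_atTop
  have hpow : Tendsto (fun t : ℝ => |t| ^ (α - 1)) (cocompact ℝ) atTop :=
    (tendsto_rpow_atTop (by linarith)).comp habs
  filter_upwards [eventually_lt_of_lt_liminf hα, hV.eventually_pos, habs.eventually_gt_atTop 1,
    hpow.eventually_ge_atTop K] with t h1 h2 h3 h4
  have h1 : α < Real.log (V t) / Real.log |t| := by exact_mod_cast h1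
  have hlog : 0 < Real.log |t| := Real.log_pos h3
  rw [lt_div_iff₀ hlog] at h1
  have hVt : |t| ^ α ≤ V t := by
    rw [← Real.log_le_log_iff (by positivity) h2, Real.log_rpow (by linarith)]
    exact h1.le
  calc K * |t| ≤ |t| ^ (α - 1) * |t| := by gcongr
    _ = |t| ^ α := by
        rw [Real.rpow_sub_one (by linarith : |t| ≠ 0)]
        field_simp
    _ ≤ V t := hVt

theorem exists_mul_abs_sub_le (hV : IsAdmissible V) (K : ℝ) :
    ∃ C, 0 ≤ C ∧ ∀ t, K * |t| - C ≤ V t := by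
  obtain ⟨s, hs, hsV⟩ := mem_cocompact.1 (hV.eventually_mul_abs_le K)
  have hcont : ContinuousOn (fun t => K * |t| - V t) s := by
    have := hV.continuous
    fun_prop
  obtain ⟨C, hC⟩ := hs.bddAbove_image hcont
  refine ⟨max C 0, le_max_right _ _, fun t => ?_⟩
  by_cases ht : t ∈ s
  · have := hC ⟨t, ht, rfl⟩
    simp only at this
    linarith [le_max_left C 0]
  · have : K * |t| ≤ V t := hsV ht
    linarith [le_max_right C 0]

theorem convexOn (hV : IsAdmissible V) : ConvexOn ℝ Set.univ fun t => t ^ 2 / 2 - V t := by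
  have h1 : ∀ t, HasDerivAt (fun t => t ^ 2 / 2 - V t) (t - deriv V t) t := by
    intro t
    have := ((hasDerivAt_pow 2 t).div_const 2).sub (hV.differentiable t).hasDerivAt
    refine this.congr_deriv ?_
    norm_num
  have hd1 : deriv (fun t => t ^ 2 / 2 - V t) = fun t => t - deriv V t :=
    funext fun t => (h1 t).deriv
  have h2 : ∀ t, HasDerivAt (fun t => t - deriv V t) (1 - deriv (deriv V) t) t := fun t =>
    (hasDerivAt_id t).sub (hV.differentiable_deriv t).hasDerivAt
  refine convexOn_univ_of_deriv2_nonneg (fun t => (h1 t).differentiableAt) ?_ fun t => ?_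
  · rw [hd1]
    exact fun t => (h2 t).differentiableAt
  · simp only [Function.iterate_succ, Function.iterate_zero, Function.comp_apply, id_eq]
    rw [hd1, (h2 t).deriv]
    linarith [hV.deriv_deriv_le t]

theorem add_le (hV : IsAdmissible V) (a b : ℝ) : V (a + b) + V (a - b) ≤ 2 * V a + b ^ 2 := by
  have h := hV.convexOn.2 (Set.mem_univ (a + b)) (Set.mem_univ (a - b))
    (by norm_num : (0 : ℝ) ≤ 1 / 2) (by norm_num : (0 : ℝ) ≤ 1 / 2) (by norm_num)
  have e : (1 / 2 : ℝ) • (a + b) + (1 / 2 : ℝ) • (a - b) = a := by simp only [smul_eq_mul]; ring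
  simp only [e] at h
  simp only [smul_eq_mul] at h
  nlinarith

theorem le_quadratic (hV : IsAdmissible V) (t : ℝ) :
    V t ≤ V 0 + deriv V 0 * t + t ^ 2 / 2 := by
  have hW : HasDerivAt (fun t => t ^ 2 / 2 - V t) (-deriv V 0) 0 := by
    have := ((hasDerivAt_pow 2 (0 : ℝ)).div_const 2).sub (hV.differentiable 0).hasDerivAt
    refine this.congr_deriv ?_
    norm_num
  rcases lt_trichotomy t 0 with ht | rfl | ht
  · have h := hV.convexOn.slope_le_of_hasDerivAt (Set.mem_univ t) (Set.mem_univ 0) ht hW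
    rw [slope_def_field, div_le_iff₀ (by linarith)] at h
    norm_num at h
    linarith
  · simp
  · have h := hV.convexOn.le_slope_of_hasDerivAt (Set.mem_univ 0) (Set.mem_univ t) ht hW
    rw [slope_def_field, le_div_iff₀ (by linarith)] at h
    norm_num at h
    linarith

end IsAdmissible

/-! ### Integrating out a tree -/

/-- If the coordinates are ranked in such a way that `q i` depends only on coordinates of smaller
rank, a product of functions of the increments `φ i - q i φ` is integrated out one coordinate
at a time. -/
theorem lintegral_prod_sub_le {ι α : Type*} [Fintype ι] [DecidableEq ι] [LinearOrder α]
    (ν : Measure ℝ) [SigmaFinite ν] {f : ℝ → ℝ≥0∞} (hf : Measurable f) {K : ℝ≥0∞}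
    (hK : ∀ a, ∫⁻ x, f (x - a) ∂ν ≤ K) (rank : ι → α) (q : ι → (ι → ℝ) → ℝ)
    (hq : ∀ i, Measurable (q i))
    (hrank : ∀ i j, rank i ≤ rank j → ∀ φ x, q i (Function.update φ j x) = q i φ) :
    ∫⁻ φ, ∏ i, f (φ i - q i φ) ∂(Measure.pi fun _ => ν) ≤ K ^ Fintype.card ι := by
  have key : ∀ s : Finset ι, ∀ φ,
      (∫⋯∫⁻_s, (fun φ => ∏ i ∈ s, f (φ i - q i φ)) ∂fun _ => ν) φ ≤ K ^ s.card := by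
    intro s
    induction s using Finset.induction_on_max_value rank with
    | empty => simp
    | insert a s has hmax ih =>
      intro φ
      have hmeas : ∀ t : Finset ι, Measurable fun φ : ι → ℝ => ∏ i ∈ t, f (φ i - q i φ) :=
        fun t => Finset.measurable_prod _ fun i _ =>
          hf.comp ((measurable_pi_apply i).sub (hq i))
      rw [lmarginal_insert' _ (hmeas _) has]
      have hinner : ∀ ψ : ι → ℝ, ∫⁻ x, ∏ i ∈ insert a s,
          f (Function.update ψ a x i - q i (Function.update ψ a x)) ∂ν ≤
          K * ∏ i ∈ s, f (ψ i - q i ψ) := by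
        intro ψ
        have : ∀ x, ∏ i ∈ insert a s,
            f (Function.update ψ a x i - q i (Function.update ψ a x)) =
            f (x - q a ψ) * ∏ i ∈ s, f (ψ i - q i ψ) := by
          intro x
          rw [Finset.prod_insert has]
          congr 1
          · rw [Function.update_self]
            rw [hrank a a le_rfl ψ x]
          · refine Finset.prod_congr rfl fun i hi => ?_
            rw [Function.update_of_ne (by rintro rfl; exact has hi)]
            rw [hrank i a (hmax i hi) ψ x]
        simp_rw [this]
        rw [lintegral_mul_const _ (by fun_prop)]
        gcongr
        exact hK _
      calc _ ≤ (∫⋯∫⁻_s, (fun ψ => K * ∏ i ∈ s, f (ψ i - q i ψ)) ∂fun _ => ν) φ :=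
            lmarginal_mono hinner φ
        _ = K * (∫⋯∫⁻_s, (fun ψ => ∏ i ∈ s, f (ψ i - q i ψ)) ∂fun _ => ν) φ := by
            unfold lmarginal
            rw [lintegral_const_mul]
            exact (hmeas s).comp measurable_updateFinset
        _ ≤ K * K ^ s.card := by gcongr; exact ih φ
        _ = K ^ (insert a s).card := by rw [Finset.card_insert_of_notMem has, pow_succ']
  rw [lintegral_eq_lmarginal_univ 0]
  exact key Finset.univ 0

/-! ### The reference measure -/

instance (ε : ℝ≥0) : SigmaFinite ((volume : Measure ℝ) + (ε : ℝ≥0∞) • Measure.dirac 0) := by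
  have : IsFiniteMeasure ((ε : ℝ≥0∞) • (Measure.dirac 0 : Measure ℝ)) :=
    Measure.smul_finite _ ENNReal.coe_ne_top
  infer_instance

instance {d : ℕ} (ε : ℝ≥0) (Λ : Finset (Site d)) : SigmaFinite (refMeasure ε Λ) := by
  unfold refMeasure; infer_instance

theorem volume_le_refMeasure {d : ℕ} (ε : ℝ≥0) (Λ : Finset (Site d)) :
    volume ≤ refMeasure ε Λ := by
  have h : ((volume : Measure ℝ) + (ε : ℝ≥0∞) • Measure.dirac 0).restrict {0}ᶜ = volume := by
    classical
    rw [Measure.restrict_add, Measure.restrict_smul, restrict_dirac]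
    simp
  have h2 := Measure.restrict_pi_pi
    (fun _ : Λ => (volume : Measure ℝ) + (ε : ℝ≥0∞) • Measure.dirac 0) (fun _ => {0}ᶜ)
  simp_rw [h] at h2
  rw [volume_pi, ← h2]
  exact Measure.restrict_le_self

instance {d : ℕ} (ε : ℝ≥0) (Λ : Finset (Site d)) : NeZero (refMeasure ε Λ) := by
  refine ⟨fun h => ?_⟩
  have h1 := volume_le_refMeasure ε Λ
  rw [h] at h1
  have h2 := h1 (Set.Icc 0 1)
  rw [Real.volume_Icc_pi] at h2
  simp at h2

theorem integral_exp_neg_abs : ∫ x : ℝ, Real.exp (-|x|) = 2 := by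
  rw [integral_comp_abs (f := fun x => Real.exp (-x)), integral_exp_neg_Ioi_zero]
  norm_num

theorem lintegral_exp_neg_abs_sub_le (ε : ℝ≥0) (a : ℝ) :
    ∫⁻ x, ENNReal.ofReal (Real.exp (-|x - a|)) ∂((volume : Measure ℝ) +
      (ε : ℝ≥0∞) • Measure.dirac 0) ≤ 2 + ε := by
  rw [lintegral_add_measure, lintegral_smul_measure, lintegral_dirac]
  have h1 : ∫⁻ x : ℝ, ENNReal.ofReal (Real.exp (-|x - a|)) = 2 := by
    rw [lintegral_sub_right_eq_self (fun x : ℝ => ENNReal.ofReal (Real.exp (-|x|))),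
      ← ofReal_integral_eq_lintegral_ofReal, integral_exp_neg_abs]
    · simp
    · exact Integrable.of_integral_ne_zero (by rw [integral_exp_neg_abs]; norm_num)
    · exact Eventually.of_forall fun x => (Real.exp_pos _).le
  rw [h1]
  gcongr
  rw [smul_eq_mul]
  calc (ε : ℝ≥0∞) * _ ≤ ε * 1 := by
        gcongr
        rw [ENNReal.ofReal_le_one, Real.exp_le_one_iff]
        simp
    _ = ε := mul_one _

/-! ### The energy -/

section Energy

variable {d : ℕ} {V : ℝ → ℝ} {Λ : Finset (Site d)}

theorem zeroExtend_of_mem {i : Site d} (φ : Λ → ℝ) (h : i ∈ Λ) : zeroExtend φ i = φ ⟨i, h⟩ := by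
  simp [zeroExtend, h]

theorem zeroExtend_of_notMem {i : Site d} (φ : Λ → ℝ) (h : i ∉ Λ) : zeroExtend φ i = 0 := by
  simp [zeroExtend, h]

theorem zeroExtend_add (φ ψ : Λ → ℝ) (i : Site d) :
    zeroExtend (φ + ψ) i = zeroExtend φ i + zeroExtend ψ i := by
  by_cases h : i ∈ Λ <;> simp [zeroExtend, h]

theorem zeroExtend_sub (φ ψ : Λ → ℝ) (i : Site d) :
    zeroExtend (φ - ψ) i = zeroExtend φ i - zeroExtend ψ i := by
  by_cases h : i ∈ Λ <;> simp [zeroExtend, h]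

theorem continuous_zeroExtend (i : Site d) : Continuous fun φ : Λ → ℝ => zeroExtend φ i := by
  by_cases h : i ∈ Λ
  · simp only [zeroExtend, h, dite_true]; fun_prop
  · simp only [zeroExtend, h, dite_false]; fun_prop

theorem energy_add (V : ℝ → ℝ) (η h : Site d → ℝ) (φ : Λ → ℝ) :
    energy V Λ (η + h) φ = energy V Λ η φ - ∑ i ∈ Λ, h i * zeroExtend φ i := by
  simp only [energy, Pi.add_apply, add_mul, Finset.sum_add_distrib]
  ring

theorem continuous_energy (hV : Continuous V) (η : Site d → ℝ) : Continuous (energy V Λ η) := by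
  have := fun i : Site d => continuous_zeroExtend (Λ := Λ) i
  unfold energy
  fun_prop

/-- The weighted sum over bonds by which the energy is built from the interaction. -/
noncomputable def bondSum (Λ : Finset (Site d)) (F : Site d → Site d → ℝ) : ℝ :=
  1 / (4 * d) * (1 / 2 * ∑ i ∈ Λ, ∑ j ∈ neighbours i with j ∈ Λ, F i j) +
    1 / (4 * d) * ∑ i ∈ Λ, ∑ j ∈ neighbours i with j ∉ Λ, F i j

theorem energy_eq_bondSum (V : ℝ → ℝ) (η : Site d → ℝ) (φ : Λ → ℝ) :
    energy V Λ η φ = bondSum Λ (fun i j => V (zeroExtend φ i - zeroExtend φ j)) -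
      ∑ i ∈ Λ, η i * zeroExtend φ i := by
  unfold energy bondSum
  congr 3
  refine Finset.sum_congr rfl fun i _ => Finset.sum_congr rfl fun j hj => ?_
  simp only [zeroExtend_of_notMem φ (Finset.mem_filter.1 hj).2, sub_zero]

theorem bondSum_mono {F G : Site d → Site d → ℝ}
    (h : ∀ i ∈ Λ, ∀ j ∈ neighbours i, F i j ≤ G i j) : bondSum Λ F ≤ bondSum Λ G := by
  unfold bondSum
  gcongr with i hi j hj i hi j hj
  · exact h i hi j (Finset.mem_filter.1 hj).1
  · exact h i hi j (Finset.mem_filter.1 hj).1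

theorem bondSum_add (F G : Site d → Site d → ℝ) :
    bondSum Λ (fun i j => F i j + G i j) = bondSum Λ F + bondSum Λ G := by
  simp only [bondSum, Finset.sum_add_distrib]
  ring

theorem bondSum_const_mul (c : ℝ) (F : Site d → Site d → ℝ) :
    bondSum Λ (fun i j => c * F i j) = c * bondSum Λ F := by
  simp only [bondSum, ← Finset.mul_sum]
  ring

theorem sum_filter_add_sum_filter_neighbours (F : Site d → Site d → ℝ) :
    ∑ i ∈ Λ, ∑ j ∈ neighbours i with j ∈ Λ, F i j +
      ∑ i ∈ Λ, ∑ j ∈ neighbours i with j ∉ Λ, F i j = ∑ i ∈ Λ, ∑ j ∈ neighbours i, F i j := by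
  rw [← Finset.sum_add_distrib]
  exact Finset.sum_congr rfl fun i _ => Finset.sum_filter_add_sum_filter_not _ _ _

theorem bondSum_le {F : Site d → Site d → ℝ} (hF : ∀ i j, 0 ≤ F i j) :
    bondSum Λ F ≤ 1 / (4 * d) * ∑ i ∈ Λ, ∑ j ∈ neighbours i, F i j := by
  rw [← sum_filter_add_sum_filter_neighbours, mul_add]
  unfold bondSum
  gcongr
  have : 0 ≤ ∑ i ∈ Λ, ∑ j ∈ neighbours i with j ∈ Λ, F i j :=
    Finset.sum_nonneg fun _ _ => Finset.sum_nonneg fun _ _ => hF _ _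
  linarith

theorem le_bondSum {F : Site d → Site d → ℝ} (hF : ∀ i j, 0 ≤ F i j) :
    1 / (8 * d) * ∑ i ∈ Λ, ∑ j ∈ neighbours i, F i j ≤ bondSum Λ F := by
  rw [← sum_filter_add_sum_filter_neighbours]
  unfold bondSum
  have : 0 ≤ 1 / (4 * d : ℝ) * ∑ i ∈ Λ, ∑ j ∈ neighbours i with j ∉ Λ, F i j :=
    mul_nonneg (by positivity)
      (Finset.sum_nonneg fun _ _ => Finset.sum_nonneg fun _ _ => hF _ _)
  have e : (1 : ℝ) / (8 * d) = 1 / 2 * (1 / (4 * d)) := by ring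
  rw [e]
  linarith

theorem bondSum_const_le (hd : 0 < d) {c : ℝ} (hc : 0 ≤ c) :
    bondSum Λ (fun _ _ => c) ≤ c / 2 * Λ.card := by
  have : (d : ℝ) ≠ 0 := by positivity
  refine (bondSum_le fun _ _ => hc).trans_eq ?_
  simp only [Finset.sum_const, card_neighbours, nsmul_eq_mul]
  push_cast
  field_simp
  ring

/-- The sum of the absolute increments along the lines in the first coordinate direction. -/
noncomputable def lineVariation (hd : 0 < d) (φ : Λ → ℝ) : ℝ :=
  ∑ i ∈ Λ, |zeroExtend φ i - zeroExtend φ (i - Pi.single ⟨0, hd⟩ 1)|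

theorem le_energy (hd : 0 < d) {K C : ℝ} (hK : 0 ≤ K) (hC : 0 ≤ C)
    (hV : ∀ t, 8 * d * K * |t| - C ≤ V t) (η : Site d → ℝ) (φ : Λ → ℝ) :
    K * lineVariation hd φ - C / 2 * Λ.card - ∑ i ∈ Λ, η i * zeroExtend φ i ≤
      energy V Λ η φ := by
  rw [energy_eq_bondSum]
  have h1 : bondSum Λ (fun i j => 8 * d * K * |zeroExtend φ i - zeroExtend φ j|) ≤
      bondSum Λ (fun i j => V (zeroExtend φ i - zeroExtend φ j)) +
      bondSum Λ (fun _ _ => C) := by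
    rw [← bondSum_add]
    exact bondSum_mono fun i _ j _ => by linarith [hV (zeroExtend φ i - zeroExtend φ j)]
  have h2 := bondSum_const_le (Λ := Λ) hd hC
  have h3 := le_bondSum (Λ := Λ) (F := fun i j => 8 * d * K * |zeroExtend φ i - zeroExtend φ j|)
    (fun _ _ => by positivity)
  have h4 : K * lineVariation hd φ ≤ 1 / (8 * d) *
      ∑ i ∈ Λ, ∑ j ∈ neighbours i, 8 * d * K * |zeroExtend φ i - zeroExtend φ j| := by
    have hd' : (d : ℝ) ≠ 0 := by positivity
    simp only [← Finset.mul_sum]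
    rw [← mul_assoc]
    have e : 1 / (8 * d) * (8 * d * K) = K := by field_simp
    rw [e, lineVariation]
    gcongr with i _
    exact Finset.single_le_sum (f := fun j => |zeroExtend φ i - zeroExtend φ j|)
      (fun _ _ => abs_nonneg _) (mem_neighbours_iff_exists.2 ⟨_, Or.inr rfl⟩)
  linarith

theorem abs_zeroExtend_le (hd : 0 < d) {L : ℕ} (φ : box d L → ℝ) (i : Site d)  :
    |zeroExtend φ i| ≤ (2 * L + 1) * lineVariation hd φ := by
  have hvar : 0 ≤ lineVariation hd φ := Finset.sum_nonneg fun _ _ => abs_nonneg _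
  by_cases hi : i ∈ box d L
  swap
  · rw [zeroExtend_of_notMem φ hi, abs_zero]; positivity
  let e : Site d := Pi.single ⟨0, hd⟩ 1
  have hstep : ∀ n : ℕ, |zeroExtend φ i| ≤
      n * lineVariation hd φ + |zeroExtend φ (i - n • e)| := by
    intro n
    induction n with
    | zero => simp
    | succ n ih =>
      have hinc : |zeroExtend φ (i - n • e)| ≤
          lineVariation hd φ + |zeroExtend φ (i - (n + 1) • e)| := by
        by_cases hn : i - n • e ∈ box d L
        · have h1 := Finset.single_le_sum
            (f := fun i => |zeroExtend φ i - zeroExtend φ (i - Pi.single ⟨0, hd⟩ 1)|)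
            (fun _ _ => abs_nonneg _) hn
          have h2 : i - n • e - Pi.single ⟨0, hd⟩ 1 = i - (n + 1) • e := by
            rw [succ_nsmul, sub_sub]
          simp only [h2] at h1
          have h3 := abs_sub_abs_le_abs_sub (zeroExtend φ (i - n • e))
            (zeroExtend φ (i - (n + 1) • e))
          unfold lineVariation
          linarith
        · rw [zeroExtend_of_notMem φ hn, abs_zero]
          positivity
      push_cast
      linarith
  have h := hstep (2 * L + 1)
  have hout : i - (2 * L + 1) • e ∉ box d L := by
    intro hmem
    have h1 := abs_le.1 (mem_box.1 hmem ⟨0, hd⟩)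
    have h2 := abs_le.1 (mem_box.1 hi ⟨0, hd⟩)
    simp [e] at h1
    omega
  rw [zeroExtend_of_notMem φ hout, abs_zero, add_zero] at h
  exact_mod_cast h

end Energy

theorem lintegral_exp_neg_lineVariation_le {d : ℕ} (hd : 0 < d) (ε : ℝ≥0)
    (Λ : Finset (Site d)) :
    ∫⁻ φ, ENNReal.ofReal (Real.exp (-lineVariation hd φ)) ∂(refMeasure ε Λ) ≤
      (2 + ε) ^ Λ.card := by
  have h := lintegral_prod_sub_le (ι := Λ) ((volume : Measure ℝ) + (ε : ℝ≥0∞) • Measure.dirac 0)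
    (f := fun t => ENNReal.ofReal (Real.exp (-|t|))) (by fun_prop)
    (lintegral_exp_neg_abs_sub_le ε) (fun i => i.1 ⟨0, hd⟩)
    (fun i φ => zeroExtend φ (i.1 - Pi.single ⟨0, hd⟩ 1))
    (fun i => (continuous_zeroExtend _).measurable) ?_
  · rw [Fintype.card_coe] at h
    refine le_trans (le_of_eq ?_) h
    refine lintegral_congr fun φ => ?_
    rw [← ENNReal.ofReal_prod_of_nonneg fun _ _ => (Real.exp_pos _).le, ← Real.exp_sum,
      Finset.sum_neg_distrib, lineVariation, ← Finset.sum_coe_sort]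
    congr 4
    ext i
    rw [zeroExtend_of_mem φ i.2]
  · intro i j hij φ x
    by_cases hm : i.1 - Pi.single ⟨0, hd⟩ 1 ∈ Λ
    · rw [zeroExtend_of_mem _ hm, zeroExtend_of_mem _ hm]
      refine Function.update_of_ne ?_ _ _
      rintro rfl
      simp at hij
    · rw [zeroExtend_of_notMem _ hm, zeroExtend_of_notMem _ hm]

section Partition

/-! ### Partition functions -/

/-- The normalization of the Gibbs measure. -/
noncomputable def partition {d : ℕ} (V : ℝ → ℝ) (ε : ℝ≥0) (Λ : Finset (Site d))
    (η : Site d → ℝ) : ℝ :=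
  ∫ φ, Real.exp (-energy V Λ η φ) ∂(refMeasure ε Λ)

variable {d : ℕ} {V : ℝ → ℝ}

theorem integrable_exp_neg_energy (hd : 0 < d) (hV : IsAdmissible V) (ε : ℝ≥0) (L : ℕ)
    (η : Site d → ℝ) :
    Integrable (fun φ => Real.exp (-energy V (box d L) η φ)) (refMeasure ε (box d L)) := by
  let S : ℝ := (2 * L + 1) * ∑ i ∈ box d L, |η i|
  have hS : 0 ≤ S := mul_nonneg (by positivity) (Finset.sum_nonneg fun _ _ => abs_nonneg _)
  obtain ⟨C, hC, hCV⟩ := hV.exists_mul_abs_sub_le (8 * d * (S + 1))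
  have hlin : ∀ φ : box d L → ℝ, ∑ i ∈ box d L, η i * zeroExtend φ i ≤
      S * lineVariation hd φ := by
    intro φ
    simp only [S]
    rw [mul_comm (2 * (L : ℝ) + 1), mul_assoc, Finset.sum_mul]
    refine Finset.sum_le_sum fun i _ => (le_abs_self _).trans ?_
    rw [abs_mul]
    gcongr
    exact abs_zeroExtend_le hd φ i
  have hbound : ∀ φ : box d L → ℝ, Real.exp (-energy V (box d L) η φ) ≤
      Real.exp (C / 2 * (box d L).card) * Real.exp (-lineVariation hd φ) := by
    intro φ
    rw [← Real.exp_add, Real.exp_le_exp]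
    have h1 := le_energy (Λ := box d L) hd (by positivity) hC hCV η φ
    have h2 := hlin φ
    linarith
  have hmeas : Continuous fun φ : box d L → ℝ => lineVariation hd φ := by
    have := fun i : Site d => continuous_zeroExtend (Λ := box d L) i
    unfold lineVariation
    fun_prop
  have hdom : Integrable (fun φ : box d L → ℝ => Real.exp (-lineVariation hd φ))
      (refMeasure ε (box d L)) := by
    refine ⟨Continuous.aestronglyMeasurable (by fun_prop), ?_⟩
    rw [hasFiniteIntegral_iff_ofReal (Eventually.of_forall fun _ => (Real.exp_pos _).le)]
    exact (lintegral_exp_neg_lineVariation_le hd ε _).trans_lt (by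
      exact ENNReal.pow_lt_top (by simp))
  refine (hdom.const_mul (Real.exp (C / 2 * (box d L).card))).mono' ?_ ?_
  · have := continuous_energy (Λ := box d L) hV.continuous η
    exact Continuous.aestronglyMeasurable (by fun_prop)
  · refine Eventually.of_forall fun φ => ?_
    rw [Real.norm_of_nonneg (Real.exp_pos _).le]
    exact hbound φ

theorem exists_partition_zero_le (hd : 0 < d) (hV : IsAdmissible V) :
    ∃ A : ℝ, 0 < A ∧ ∀ (ε : ℝ≥0) (L : ℕ),
      partition V ε (box d L) 0 ≤ (A * (2 + ε)) ^ (box d L).card := by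
  obtain ⟨C, hC, hCV⟩ := hV.exists_mul_abs_sub_le (8 * d * 1)
  refine ⟨Real.exp (C / 2), Real.exp_pos _, fun ε L => ?_⟩
  have hbound : ∀ φ : box d L → ℝ, Real.exp (-energy V (box d L) 0 φ) ≤
      Real.exp (C / 2) ^ (box d L).card * Real.exp (-lineVariation hd φ) := by
    intro φ
    rw [← Real.exp_nat_mul, ← Real.exp_add, Real.exp_le_exp]
    have h1 := le_energy (Λ := box d L) hd zero_le_one hC hCV 0 φ
    simp only [Pi.zero_apply, zero_mul, Finset.sum_const_zero] at h1
    linarith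
  unfold partition
  rw [integral_eq_lintegral_of_nonneg_ae (Eventually.of_forall fun _ => (Real.exp_pos _).le)
    (integrable_exp_neg_energy hd hV ε L 0).aestronglyMeasurable]
  refine ENNReal.toReal_le_of_le_ofReal (by positivity) ?_
  calc ∫⁻ φ, ENNReal.ofReal (Real.exp (-energy V (box d L) 0 φ)) ∂refMeasure ε (box d L)
      ≤ ∫⁻ φ, ENNReal.ofReal (Real.exp (C / 2) ^ (box d L).card) *
          ENNReal.ofReal (Real.exp (-lineVariation hd φ)) ∂refMeasure ε (box d L) := by
        refine lintegral_mono fun φ => ?_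
        rw [← ENNReal.ofReal_mul (by positivity)]
        exact ENNReal.ofReal_le_ofReal (hbound φ)
    _ = ENNReal.ofReal (Real.exp (C / 2) ^ (box d L).card) *
          ∫⁻ φ, ENNReal.ofReal (Real.exp (-lineVariation hd φ)) ∂refMeasure ε (box d L) :=
        lintegral_const_mul' _ _ ENNReal.ofReal_ne_top
    _ ≤ ENNReal.ofReal (Real.exp (C / 2) ^ (box d L).card) * (2 + ε) ^ (box d L).card := by
        gcongr
        exact lintegral_exp_neg_lineVariation_le hd ε _
    _ = ENNReal.ofReal ((Real.exp (C / 2) * (2 + ε)) ^ (box d L).card) := by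
        rw [mul_pow, ENNReal.ofReal_mul (by positivity),
          ENNReal.ofReal_pow (p := 2 + (ε : ℝ)) (by positivity),
          ENNReal.ofReal_add (by positivity) (by positivity), ENNReal.ofReal_coe_nnreal,
          ENNReal.ofReal_ofNat]

theorem partition_pos (hd : 0 < d) (hV : IsAdmissible V) (ε : ℝ≥0) (L : ℕ) (η : Site d → ℝ) :
    0 < partition V ε (box d L) η :=
  integral_exp_pos (integrable_exp_neg_energy hd hV ε L η)

theorem isProbabilityMeasure_gibbs (hd : 0 < d) (hV : IsAdmissible V) (ε : ℝ≥0) (L : ℕ)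
    (η : Site d → ℝ) : IsProbabilityMeasure (gibbs V ε (box d L) η) :=
  isProbabilityMeasure_tilted (integrable_exp_neg_energy hd hV ε L η)

theorem integrable_zeroExtend_gibbs (hd : 0 < d) (hV : IsAdmissible V) (ε : ℝ≥0) (L : ℕ)
    (η : Site d → ℝ) {i : Site d} (hi : i ∈ box d L) :
    Integrable (fun φ => zeroExtend φ i) (gibbs V ε (box d L) η) := by
  have hint := integrable_exp_neg_energy hd hV ε L
  rw [gibbs, integrable_tilted_iff]
  swap
  · exact hint η
  have hshift : ∀ (c : ℝ) (φ : box d L → ℝ), -energy V (box d L) (η + Pi.single i c) φ =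
      -energy V (box d L) η φ + c * zeroExtend φ i := by
    intro c φ
    rw [energy_add]
    have : ∑ j ∈ box d L, (Pi.single i c : Site d → ℝ) j * zeroExtend φ j =
        c * zeroExtend φ i := by
      rw [Finset.sum_eq_single i]
      · simp
      · intro j _ hj; simp [hj]
      · exact fun h => absurd hi h
    rw [this]; ring
  refine ((hint (η + Pi.single i 1)).add (hint (η + Pi.single i (-1)))).mono' ?_ ?_
  · have := continuous_energy (Λ := box d L) hV.continuous η
    have := continuous_zeroExtend (Λ := box d L) i
    exact Continuous.aestronglyMeasurable (by fun_prop)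
  · refine Eventually.of_forall fun φ => ?_
    simp only [Pi.add_apply, hshift, Real.exp_add, smul_eq_mul, norm_mul]
    rw [Real.norm_of_nonneg (Real.exp_pos _).le, ← mul_add, Real.norm_eq_abs]
    gcongr
    have h1 := Real.add_one_le_exp (1 * zeroExtend φ i)
    have h2 := Real.add_one_le_exp (-1 * zeroExtend φ i)
    have h3 := Real.exp_pos (1 * zeroExtend φ i)
    have h4 := Real.exp_pos (-1 * zeroExtend φ i)
    rcases abs_cases (zeroExtend φ i) with h | h <;> linarith

/-- Convexity of the logarithm of the partition function in the external field. -/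
theorem log_partition_sub_ge (hd : 0 < d) (hV : IsAdmissible V) (ε : ℝ≥0) (L : ℕ)
    (η h : Site d → ℝ) :
    ∑ i ∈ box d L, h i * magnetization V ε (box d L) η i ≤
      Real.log (partition V ε (box d L) (η + h)) - Real.log (partition V ε (box d L) η) := by
  have hint := integrable_exp_neg_energy hd hV ε L
  have := isProbabilityMeasure_gibbs hd hV ε L η
  let X : (box d L → ℝ) → ℝ := fun φ => ∑ i ∈ box d L, h i * zeroExtend φ i
  have hsum : ∀ φ, ((fun φ => -energy V (box d L) η φ) + X) φ =
      -energy V (box d L) (η + h) φ := fun φ => by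
    simp only [Pi.add_apply, energy_add, X]; ring
  have hX : Integrable X (gibbs V ε (box d L) η) :=
    integrable_finsetSum _ fun i hi => (integrable_zeroExtend_gibbs hd hV ε L η hi).const_mul _
  have hexp : Integrable (fun φ => Real.exp (X φ)) (gibbs V ε (box d L) η) := by
    rw [gibbs, integrable_tilted_iff]
    swap
    · exact hint η
    refine (hint (η + h)).congr (Eventually.of_forall fun φ => ?_)
    simp only [← hsum, Pi.add_apply, Real.exp_add, smul_eq_mul]
  have hJ := convexOn_exp.map_integral_le Real.continuous_exp.continuousOn isClosed_univ
    (Eventually.of_forall fun _ => Set.mem_univ _) hX hexp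
  have hratio : ∫ φ, Real.exp (X φ) ∂gibbs V ε (box d L) η =
      partition V ε (box d L) (η + h) / partition V ε (box d L) η := by
    rw [gibbs, integral_exp_tilted]
    simp_rw [hsum]
    rfl
  have hmean : ∫ φ, X φ ∂gibbs V ε (box d L) η =
      ∑ i ∈ box d L, h i * magnetization V ε (box d L) η i := by
    simp only [X]
    rw [integral_finsetSum _ fun i hi =>
      (integrable_zeroExtend_gibbs hd hV ε L η hi).const_mul _]
    simp only [integral_const_mul, magnetization]
  rw [hratio, hmean] at hJ
  rw [← Real.log_div (partition_pos hd hV ε L _).ne' (partition_pos hd hV ε L _).ne']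
  exact (Real.le_log_iff_exp_le
    (div_pos (partition_pos hd hV ε L _) (partition_pos hd hV ε L _))).2 hJ

theorem log_partition_sub_le_overlap (hd : 0 < d) (hV : IsAdmissible V) (ε : ℝ≥0) (L : ℕ)
    (η : Site d → ℝ) :
    Real.log (partition V ε (box d L) η) - Real.log (partition V ε (box d L) 0) ≤
      overlap V ε (box d L) η := by
  have h := log_partition_sub_ge hd hV ε L η (-η)
  rw [add_neg_cancel] at h
  simp only [Pi.neg_apply, neg_mul, Finset.sum_neg_distrib] at h
  unfold overlap
  linarith

theorem sum_mul_magnetization_zero_le_overlap (hd : 0 < d) (hV : IsAdmissible V) (ε : ℝ≥0) (L : ℕ)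
    (η : Site d → ℝ) :
    ∑ i ∈ box d L, η i * magnetization V ε (box d L) 0 i ≤ overlap V ε (box d L) η := by
  have h := log_partition_sub_ge hd hV ε L 0 η
  rw [zero_add] at h
  exact h.trans (log_partition_sub_le_overlap hd hV ε L η)

theorem energy_add_energy_le (hd : 0 < d) (hV : IsAdmissible V) {Λ : Finset (Site d)}
    (η : Site d → ℝ) (m ψ : Λ → ℝ) (hψ : ψ ∈ Set.Icc 0 1) :
    energy V Λ η (m + ψ) + energy V Λ η (m - ψ) ≤ 2 * energy V Λ η m + 1 / 2 * Λ.card := by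
  have hψ' : ∀ i, zeroExtend ψ i ∈ Set.Icc (0 : ℝ) 1 := by
    intro i
    by_cases h : i ∈ Λ
    · rw [zeroExtend_of_mem ψ h]; exact ⟨hψ.1 _, hψ.2 _⟩
    · rw [zeroExtend_of_notMem ψ h]; simp
  have hc := bondSum_const_le (Λ := Λ) hd zero_le_one
  have hb : bondSum Λ (fun i j => V (zeroExtend (m + ψ) i - zeroExtend (m + ψ) j)) +
      bondSum Λ (fun i j => V (zeroExtend (m - ψ) i - zeroExtend (m - ψ) j)) ≤
      2 * bondSum Λ (fun i j => V (zeroExtend m i - zeroExtend m j)) +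
        bondSum Λ (fun _ _ => (1 : ℝ)) := by
    rw [← bondSum_add, ← bondSum_const_mul, ← bondSum_add]
    refine bondSum_mono fun i _ j _ => ?_
    have h := hV.add_le (zeroExtend m i - zeroExtend m j) (zeroExtend ψ i - zeroExtend ψ j)
    have hsq : (zeroExtend ψ i - zeroExtend ψ j) ^ 2 ≤ 1 := by
      rw [sq_le_one_iff_abs_le_one, abs_le]
      have h1 := hψ' i
      have h2 := hψ' j
      constructor <;> linarith [h1.1, h1.2, h2.1, h2.2]
    simp only [zeroExtend_add, zeroExtend_sub]
    rw [add_sub_add_comm, sub_sub_sub_comm]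
    linarith
  have hlin : ∑ i ∈ Λ, η i * zeroExtend (m + ψ) i + ∑ i ∈ Λ, η i * zeroExtend (m - ψ) i =
      2 * ∑ i ∈ Λ, η i * zeroExtend m i := by
    rw [Finset.mul_sum, ← Finset.sum_add_distrib]
    refine Finset.sum_congr rfl fun i _ => ?_
    rw [zeroExtend_add, zeroExtend_sub]; ring
  simp only [energy_eq_bondSum]
  linarith

/-- Symmetrizing the fluctuations around an arbitrary configuration `m` bounds the partition
function from below. -/
theorem neg_energy_le_log_partition (hd : 0 < d) (hV : IsAdmissible V) (ε : ℝ≥0) (L : ℕ)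
    (η : Site d → ℝ) (m : box d L → ℝ) :
    -energy V (box d L) η m - 1 / 4 * (box d L).card ≤
      Real.log (partition V ε (box d L) η) := by
  rw [Real.le_log_iff_exp_le (partition_pos hd hV ε L η)]
  have hint := integrable_exp_neg_energy hd hV ε L η
  have hvol : Integrable (fun φ => Real.exp (-energy V (box d L) η φ)) volume :=
    hint.mono_measure (volume_le_refMeasure ε _)
  have hplus : Integrable (fun ψ => Real.exp (-energy V (box d L) η (m + ψ))) volume :=
    hvol.comp_add_left m
  have hminus : Integrable (fun ψ => Real.exp (-energy V (box d L) η (m - ψ))) volume :=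
    hvol.comp_sub_left m
  have h1 : ∫ φ, Real.exp (-energy V (box d L) η φ) ≤ partition V ε (box d L) η :=
    integral_mono_measure (volume_le_refMeasure ε _)
      (Eventually.of_forall fun _ => (Real.exp_pos _).le) hint
  have e1 : ∫ ψ, Real.exp (-energy V (box d L) η (m + ψ)) =
      ∫ φ, Real.exp (-energy V (box d L) η φ) :=
    integral_add_left_eq_self (fun φ => Real.exp (-energy V (box d L) η φ)) m
  have e2 : ∫ ψ, Real.exp (-energy V (box d L) η (m - ψ)) =
      ∫ φ, Real.exp (-energy V (box d L) η φ) :=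
    integral_sub_left_eq_self (fun φ => Real.exp (-energy V (box d L) η φ)) volume m
  let c : ℝ := Real.exp (-energy V (box d L) η m - 1 / 4 * (box d L).card)
  let Q : Set (box d L → ℝ) := Set.Icc 0 1
  have hQ : volume.real Q = 1 := by
    rw [measureReal_def, Real.volume_Icc_pi]; simp
  have hlow : ∫ ψ in Q, 2 * c ≤ ∫ ψ, (Real.exp (-energy V (box d L) η (m + ψ)) +
      Real.exp (-energy V (box d L) η (m - ψ))) := by
    refine le_trans (setIntegral_mono_on ?_ (hplus.add hminus).integrableOn measurableSet_Icc
      fun ψ hψ => ?_) (setIntegral_le_integral (hplus.add hminus)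
        (Eventually.of_forall fun _ => by simp only [Pi.zero_apply, Pi.add_apply]; positivity))
    · exact integrableOn_const (by rw [Real.volume_Icc_pi]; simp)
    · have h := energy_add_energy_le hd hV η m ψ hψ
      set a := -energy V (box d L) η (m + ψ) with ha
      set b := -energy V (box d L) η (m - ψ) with hb
      have hc : c ≤ Real.exp ((a + b) / 2) := Real.exp_le_exp.2 (by linarith)
      have hsq : Real.exp a = Real.exp (a / 2) ^ 2 := by
        rw [← Real.exp_nat_mul]; congr 1; push_cast; ring
      have hsq' : Real.exp b = Real.exp (b / 2) ^ 2 := by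
        rw [← Real.exp_nat_mul]; congr 1; push_cast; ring
      have hmul : Real.exp ((a + b) / 2) = Real.exp (a / 2) * Real.exp (b / 2) := by
        rw [← Real.exp_add]; congr 1; ring
      simp only [Pi.add_apply]
      nlinarith [sq_nonneg (Real.exp (a / 2) - Real.exp (b / 2))]
  rw [setIntegral_const, hQ, one_smul, integral_add hplus hminus, e1, e2] at hlow
  change c ≤ _
  linarith

/-! ### Measurability in the external field -/

theorem measurable_magnetization (hV : Continuous V) (ε : ℝ≥0) (Λ : Finset (Site d)) (i : Site d) :
    Measurable fun η : Site d → ℝ => magnetization V ε Λ η i := by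
  have hE : Measurable fun p : (Site d → ℝ) × (Λ → ℝ) => energy V Λ p.1 p.2 := by
    have hz : ∀ i : Site d, Measurable fun p : (Site d → ℝ) × (Λ → ℝ) => zeroExtend p.2 i :=
      fun i => (continuous_zeroExtend i).measurable.comp measurable_snd
    have hVm := hV.measurable
    unfold energy
    fun_prop
  have hz : Measurable fun p : (Site d → ℝ) × (Λ → ℝ) => zeroExtend p.2 i :=
    (continuous_zeroExtend i).measurable.comp measurable_snd
  unfold magnetization gibbs
  simp_rw [integral_tilted]
  have hZ : Measurable fun η : Site d → ℝ => ∫ φ, Real.exp (-energy V Λ η φ) ∂refMeasure ε Λ :=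
    (StronglyMeasurable.integral_prod_right (f := fun η φ => Real.exp (-energy V Λ η φ))
      (Measurable.stronglyMeasurable (by
        change Measurable fun p : (Site d → ℝ) × (Λ → ℝ) => Real.exp (-energy V Λ p.1 p.2)
        fun_prop))).measurable
  refine (StronglyMeasurable.integral_prod_right (f := fun η φ =>
    (Real.exp (-energy V Λ η φ) / ∫ φ, Real.exp (-energy V Λ η φ) ∂refMeasure ε Λ) •
      zeroExtend φ i) (Measurable.stronglyMeasurable ?_)).measurable
  change Measurable fun p : (Site d → ℝ) × (Λ → ℝ) => (Real.exp (-energy V Λ p.1 p.2) /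
    ∫ φ, Real.exp (-energy V Λ p.1 φ) ∂refMeasure ε Λ) • zeroExtend p.2 i
  have : Measurable fun p : (Site d → ℝ) × (Λ → ℝ) =>
      ∫ φ, Real.exp (-energy V Λ p.1 φ) ∂refMeasure ε Λ := hZ.comp measurable_fst
  fun_prop

theorem measurable_overlap (hV : Continuous V) (ε : ℝ≥0) (Λ : Finset (Site d)) :
    Measurable fun η : Site d → ℝ => overlap V ε Λ η := by
  have := measurable_magnetization hV ε Λ
  unfold overlap
  fun_prop

end Partition

section Disorder

variable {d : ℕ} {Ω : Type*} [MeasurableSpace Ω] {P : Measure Ω}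
  {η : Site d → Ω → ℝ}

/-! ### Expectations with values in the extended reals -/

theorem extExpectation_of_integrable {X : Ω → ℝ} (hX : Integrable X P) :
    extExpectation P X = ((∫ ω, X ω ∂P : ℝ) : EReal) := by
  rw [extExpectation, integral_eq_lintegral_pos_part_sub_lintegral_neg_part hX, EReal.coe_sub,
    ← EReal.toReal_coe_ennreal, ← EReal.toReal_coe_ennreal, EReal.coe_toReal _ (by simp),
    EReal.coe_toReal _ (by simp)]
  · simpa using hX.neg.lintegral_lt_top.ne
  · simpa using hX.lintegral_lt_top.ne

theorem extExpectation_mono {X Y : Ω → ℝ} (h : ∀ ω, X ω ≤ Y ω) :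
    extExpectation P X ≤ extExpectation P Y := by
  refine EReal.sub_le_sub ?_ ?_
  · exact_mod_cast lintegral_mono fun ω => ENNReal.ofReal_le_ofReal (h ω)
  · exact_mod_cast lintegral_mono fun ω => ENNReal.ofReal_le_ofReal (neg_le_neg (h ω))

/-! ### Sums over bonds of random variables -/

theorem integrable_bondSum {Λ : Finset (Site d)} {F : Site d → Site d → Ω → ℝ}
    (hF : ∀ i j, Integrable (F i j) P) : Integrable (fun ω => bondSum Λ fun i j => F i j ω) P := by
  unfold bondSum
  exact (((integrable_finsetSum _ fun i _ => integrable_finsetSum _ fun j _ =>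
    hF i j).const_mul _).const_mul _).add
    ((integrable_finsetSum _ fun i _ => integrable_finsetSum _ fun j _ => hF i j).const_mul _)

theorem integral_bondSum {Λ : Finset (Site d)} {F : Site d → Site d → Ω → ℝ}
    (hF : ∀ i j, Integrable (F i j) P) :
    ∫ ω, bondSum Λ (fun i j => F i j ω) ∂P = bondSum Λ fun i j => ∫ ω, F i j ω ∂P := by
  unfold bondSum
  have hs : ∀ (p : Site d → Prop) [DecidablePred p], ∀ i ∈ Λ, Integrable (fun ω =>
      ∑ j ∈ neighbours i with p j, F i j ω) P := fun p _ i _ =>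
    integrable_finsetSum _ fun j _ => hF i j
  rw [integral_add, integral_const_mul, integral_const_mul, integral_const_mul,
    integral_finsetSum _ (hs _), integral_finsetSum _ (hs _)]
  · simp_rw [integral_finsetSum _ fun j _ => hF _ j]
  · exact ((integrable_finsetSum _ (hs _)).const_mul _).const_mul _
  · exact (integrable_finsetSum _ (hs _)).const_mul _

/-! ### Linear combinations of the random fields -/

namespace IsSymmetricIID

theorem memLp_apply (hη : IsSymmetricIID P η) (i : Site d) : MemLp (η i) 2 P :=
  (hη.identDistrib i).memLp_iff.2 hη.memLp

theorem integral_apply (hη : IsSymmetricIID P η) (i : Site d) : ∫ ω, η i ω ∂P = 0 := by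
  rw [(hη.identDistrib i).integral_eq]
  have h := hη.symmetric.integral_eq
  simp only [Pi.neg_apply, integral_neg] at h
  linarith

theorem integrable_mul (hη : IsSymmetricIID P η) (i j : Site d) :
    Integrable (fun ω => η i ω * η j ω) P :=
  (hη.memLp_apply i).integrable_mul (hη.memLp_apply j)

theorem integral_mul (hη : IsSymmetricIID P η) (i j : Site d) :
    ∫ ω, η i ω * η j ω ∂P = if i = j then ∫ ω, η 0 ω ^ 2 ∂P else 0 := by
  split_ifs with h
  · subst h
    have := ((hη.identDistrib i).comp (measurable_id.pow_const 2)).integral_eq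
    simpa [Function.comp_def, sq] using this
  · have := (hη.indep.indepFun h).integral_mul_eq_mul_integral
      (hη.memLp_apply i).aestronglyMeasurable (hη.memLp_apply j).aestronglyMeasurable
    simpa [hη.integral_apply] using this

theorem aemeasurable (hη : IsSymmetricIID P η) : AEMeasurable (fun ω i => η i ω) P :=
  aemeasurable_pi_lambda _ fun i => (hη.identDistrib i).aemeasurable_fst

theorem integrable_mul_sum_mul (hη : IsSymmetricIID P η) (B : Finset (Site d)) (a : Site d → ℝ)
    (i : Site d) : Integrable (fun ω => η i ω * ∑ k ∈ B, a k * η k ω) P := by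
  simp_rw [Finset.mul_sum, mul_left_comm (η i _)]
  exact integrable_finsetSum _ fun k _ => (hη.integrable_mul i k).const_mul _

theorem integral_mul_sum_mul (hη : IsSymmetricIID P η) (B : Finset (Site d)) (a : Site d → ℝ)
    (i : Site d) : ∫ ω, η i ω * ∑ k ∈ B, a k * η k ω ∂P =
      if i ∈ B then a i * ∫ ω, η 0 ω ^ 2 ∂P else 0 := by
  simp_rw [Finset.mul_sum, mul_left_comm (η i _)]
  rw [integral_finsetSum _ fun k _ => (hη.integrable_mul i k).const_mul _]
  simp [integral_const_mul, hη.integral_mul]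

theorem integrable_sum_mul_sq (hη : IsSymmetricIID P η) (B : Finset (Site d)) (a : Site d → ℝ) :
    Integrable (fun ω => (∑ k ∈ B, a k * η k ω) ^ 2) P := by
  simp_rw [sq]
  simp_rw [Finset.sum_mul, mul_assoc]
  exact integrable_finsetSum _ fun k _ => (hη.integrable_mul_sum_mul B a k).const_mul _

theorem integral_sum_mul_sq (hη : IsSymmetricIID P η) (B : Finset (Site d)) (a : Site d → ℝ) :
    ∫ ω, (∑ k ∈ B, a k * η k ω) ^ 2 ∂P = (∫ ω, η 0 ω ^ 2 ∂P) * ∑ k ∈ B, a k ^ 2 := by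
  simp_rw [sq (∑ k ∈ B, _)]
  simp_rw [Finset.sum_mul, mul_assoc]
  rw [integral_finsetSum _ fun k _ => (hη.integrable_mul_sum_mul B a k).const_mul _,
    Finset.mul_sum]
  refine Finset.sum_congr rfl fun k hk => ?_
  rw [integral_const_mul, hη.integral_mul_sum_mul, if_pos hk]
  ring

variable [IsProbabilityMeasure P]

theorem integrable_apply (hη : IsSymmetricIID P η) (i : Site d) : Integrable (η i) P :=
  (hη.memLp_apply i).integrable (by norm_num)

theorem integrable_sum_mul (hη : IsSymmetricIID P η) (B : Finset (Site d)) (a : Site d → ℝ) :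
    Integrable (fun ω => ∑ k ∈ B, a k * η k ω) P :=
  integrable_finsetSum _ fun k _ => (hη.integrable_apply k).const_mul _

theorem integral_sum_mul (hη : IsSymmetricIID P η) (B : Finset (Site d)) (a : Site d → ℝ) :
    ∫ ω, ∑ k ∈ B, a k * η k ω ∂P = 0 := by
  rw [integral_finsetSum _ fun k _ => (hη.integrable_apply k).const_mul _]
  simp [integral_const_mul, hη.integral_apply]

end IsSymmetricIID

variable [IsProbabilityMeasure P]

/-! ### A test configuration built from a finitely supported function -/

theorem sub_notMem_box {M R : ℕ} {i k : Site d} (hi : i ∉ box d (M + R)) (hk : k ∈ box d M) :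
    i - k ∉ box d R := by
  intro h
  refine hi (mem_box.2 fun l => ?_)
  have h1 := abs_le.1 (mem_box.1 h l)
  have h2 := abs_le.1 (mem_box.1 hk l)
  simp only [Pi.sub_apply] at h1
  rw [abs_le]
  push_cast
  omega

theorem sum_neighbours_translate (S : Finset (Site d)) (F : Site d → Site d → ℝ) (k : Site d) :
    ∑ i ∈ S, ∑ j ∈ neighbours i, F (i - k) (j - k) =
      ∑ i ∈ S.map (Equiv.subRight k).toEmbedding, ∑ j ∈ neighbours i, F i j := by
  rw [Finset.sum_map]
  refine Finset.sum_congr rfl fun i _ => ?_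
  simp only [sum_neighbours, Equiv.coe_toEmbedding, Equiv.subRight_apply]
  refine Finset.sum_congr rfl fun l _ => ?_
  rw [add_sub_right_comm, sub_right_comm i (Pi.single l 1)]

theorem bondSum_sum_sq_le (hd : 0 < d) {M R : ℕ} {f : Site d → ℝ}
    (hf : ∀ i, i ∉ box d R → f i = 0) {D : ℝ}
    (hD : ∀ S : Finset (Site d), ∑ i ∈ S, ∑ j ∈ neighbours i, (f i - f j) ^ 2 ≤ 8 * d * D) :
    bondSum (box d (M + R + 1)) (fun i j => ∑ k ∈ box d M, (f (i - k) - f (j - k)) ^ 2) ≤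
      (box d M).card * D := by
  have hd' : (0 : ℝ) < d := by exact_mod_cast hd
  set Λ := box d (M + R + 1) with hΛ
  have hbdry : ∑ i ∈ Λ, ∑ j ∈ neighbours i with j ∉ Λ,
      ∑ k ∈ box d M, (f (i - k) - f (j - k)) ^ 2 = 0 := by
    refine Finset.sum_eq_zero fun i _ => Finset.sum_eq_zero fun j hj =>
      Finset.sum_eq_zero fun k hk => ?_
    obtain ⟨hji, hj⟩ := Finset.mem_filter.1 hj
    have hi : i ∉ box d (M + R) := fun h => hj (mem_box_succ_of_mem_neighbours h hji)
    have hj' : j ∉ box d (M + R) := fun h => hj (box_mono d (Nat.le_succ _) h)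
    rw [hf _ (sub_notMem_box hi hk), hf _ (sub_notMem_box hj' hk)]
    ring
  have hall : ∑ i ∈ Λ, ∑ j ∈ neighbours i, ∑ k ∈ box d M, (f (i - k) - f (j - k)) ^ 2 ≤
      (box d M).card * (8 * d * D) := by
    have : ∑ i ∈ Λ, ∑ j ∈ neighbours i, ∑ k ∈ box d M, (f (i - k) - f (j - k)) ^ 2 =
        ∑ k ∈ box d M, ∑ i ∈ Λ, ∑ j ∈ neighbours i, (f (i - k) - f (j - k)) ^ 2 := by
      rw [Finset.sum_comm]
      exact Finset.sum_congr rfl fun i _ => Finset.sum_comm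
    rw [this, ← nsmul_eq_mul]
    refine Finset.sum_le_card_nsmul _ _ _ fun k _ => ?_
    rw [sum_neighbours_translate Λ (fun i j => (f i - f j) ^ 2) k]
    exact hD _
  rw [← sum_filter_add_sum_filter_neighbours, hbdry, add_zero] at hall
  rw [bondSum, hbdry]
  calc _ ≤ 1 / (4 * d) * (1 / 2 * ((box d M).card * (8 * d * D))) + 1 / (4 * d : ℝ) * 0 := by
        gcongr
    _ = _ := by field_simp; ring

/-- The disorder average of the energy of the test configuration `f * η`. -/
theorem exists_energy_le (hd : 0 < d) {V : ℝ → ℝ} (hV : IsAdmissible V)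
    (hη : IsSymmetricIID P η) {M R : ℕ} {f : Site d → ℝ} (hf : ∀ i, i ∉ box d R → f i = 0)
    (hD : ∀ S : Finset (Site d), ∑ i ∈ S, ∑ j ∈ neighbours i, (f i - f j) ^ 2 ≤ 8 * d * f 0) :
    ∃ (m : Ω → box d (M + R + 1) → ℝ) (Y : Ω → ℝ), Integrable Y P ∧
      (∀ ω, energy V (box d (M + R + 1)) (fun i => η i ω) (m ω) ≤ Y ω) ∧
      ∫ ω, Y ω ∂P ≤ |V 0| / 2 * (box d (M + R + 1)).card -
        (∫ ω, η 0 ω ^ 2 ∂P) / 2 * (box d M).card * f 0 := by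
  set Λ := box d (M + R + 1) with hΛ
  set σ := ∫ ω, η 0 ω ^ 2 ∂P with hσ
  have hσ0 : 0 ≤ σ := integral_nonneg fun _ => sq_nonneg _
  let X : Site d → Ω → ℝ := fun i ω => ∑ k ∈ box d M, f (i - k) * η k ω
  let m : Ω → Λ → ℝ := fun ω i => X i ω
  have hm : ∀ ω i, zeroExtend (m ω) i = X i ω := by
    intro ω i
    by_cases hi : i ∈ Λ
    · rw [zeroExtend_of_mem _ hi]
    · rw [zeroExtend_of_notMem _ hi]
      refine (Finset.sum_eq_zero fun k hk => ?_).symm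
      rw [hf _ (sub_notMem_box (fun h => hi (box_mono d (Nat.le_succ _) h)) hk), zero_mul]
  have hdiff : ∀ i j ω, X i ω - X j ω =
      ∑ k ∈ box d M, (f (i - k) - f (j - k)) * η k ω := by
    intro i j ω
    simp only [X, ← Finset.sum_sub_distrib, sub_mul]
  let F : Site d → Site d → Ω → ℝ := fun i j ω =>
    V 0 + deriv V 0 * (X i ω - X j ω) + (X i ω - X j ω) ^ 2 / 2
  have hlin : ∀ i j, Integrable (fun ω => X i ω - X j ω) P := by
    intro i j
    simp_rw [hdiff]
    exact hη.integrable_sum_mul _ _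
  have hsq : ∀ i j, Integrable (fun ω => (X i ω - X j ω) ^ 2) P := by
    intro i j
    simp_rw [hdiff]
    exact hη.integrable_sum_mul_sq _ _
  have hF : ∀ i j, Integrable (F i j) P := fun i j =>
    ((integrable_const _).add ((hlin i j).const_mul _)).add ((hsq i j).div_const _)
  have hFint : ∀ i j, ∫ ω, F i j ω ∂P =
      V 0 + σ / 2 * ∑ k ∈ box d M, (f (i - k) - f (j - k)) ^ 2 := by
    intro i j
    simp only [F]
    rw [integral_add (by exact (integrable_const _).add ((hlin i j).const_mul _))
      ((hsq i j).div_const _), integral_add (integrable_const _) ((hlin i j).const_mul _),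
      integral_const_mul, integral_div]
    simp_rw [hdiff]
    rw [hη.integral_sum_mul, hη.integral_sum_mul_sq]
    simp
    ring
  have hηX : ∀ i, Integrable (fun ω => η i ω * X i ω) P := fun i =>
    hη.integrable_mul_sum_mul _ _ _
  have hBΛ : box d M ⊆ Λ := box_mono d (by omega)
  have hover : ∑ i ∈ Λ, ∫ ω, η i ω * X i ω ∂P = σ * (box d M).card * f 0 := by
    simp only [X]
    simp_rw [fun i => hη.integral_mul_sum_mul (box d M) (fun k => f (i - k)) i, sub_self]
    rw [← Finset.sum_filter, Finset.filter_mem_eq_inter, Finset.inter_eq_right.2 hBΛ,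
      Finset.sum_const, nsmul_eq_mul]
    ring
  refine ⟨m, fun ω => bondSum Λ (fun i j => F i j ω) - ∑ i ∈ Λ, η i ω * X i ω,
    (integrable_bondSum hF).sub (integrable_finsetSum _ fun i _ => hηX i), fun ω => ?_, ?_⟩
  · rw [energy_eq_bondSum]
    simp_rw [hm]
    gcongr
    exact bondSum_mono fun i _ j _ => hV.le_quadratic _
  · rw [integral_sub (integrable_bondSum hF) (integrable_finsetSum _ fun i _ => hηX i),
      integral_finsetSum _ fun i _ => hηX i, hover, integral_bondSum hF]
    simp_rw [hFint]
    rw [bondSum_add, bondSum_const_mul]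
    have h1 : bondSum Λ (fun _ _ => V 0) ≤ |V 0| / 2 * Λ.card :=
      (bondSum_mono fun _ _ _ _ => le_abs_self _).trans (bondSum_const_le hd (abs_nonneg _))
    have h2 := mul_le_mul_of_nonneg_left (bondSum_sum_sq_le (M := M) hd hf hD)
      (by positivity : 0 ≤ σ / 2)
    linarith

end Disorder

/-! ### Bounds on the disorder average of the overlap -/

section Overlap

variable {d : ℕ} {V : ℝ → ℝ} {Ω : Type*} [MeasurableSpace Ω] {P : Measure Ω}
  {η : Site d → Ω → ℝ}

theorem extExpectation_overlap_eq_sum (ε : ℝ≥0) {Λ : Finset (Site d)}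
    (h : ∀ i ∈ Λ, Integrable (fun ω => η i ω * magnetization V ε Λ (fun j => η j ω) i) P) :
    extExpectation P (fun ω => overlap V ε Λ fun i => η i ω) =
      ((∑ i ∈ Λ, ∫ ω, η i ω * magnetization V ε Λ (fun j => η j ω) i ∂P : ℝ) : EReal) := by
  unfold overlap
  rw [extExpectation_of_integrable (integrable_finsetSum _ h), integral_finsetSum _ h]

variable [IsProbabilityMeasure P]

theorem extExpectation_overlap_nonneg (hd : 0 < d) (hV : IsAdmissible V)
    (hη : IsSymmetricIID P η) (ε : ℝ≥0) (L : ℕ) :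
    0 ≤ extExpectation P fun ω => overlap V ε (box d L) fun i => η i ω := by
  have hint := hη.integrable_sum_mul (box d L) (magnetization V ε (box d L) 0)
  calc (0 : EReal) = extExpectation P fun ω =>
        ∑ i ∈ box d L, magnetization V ε (box d L) 0 i * η i ω := by
        rw [extExpectation_of_integrable hint, hη.integral_sum_mul, EReal.coe_zero]
    _ ≤ _ := extExpectation_mono fun ω => by
        simpa only [mul_comm] using
          sum_mul_magnetization_zero_le_overlap hd hV ε L fun i => η i ω

theorem lintegral_neg_overlap_ne_top (hd : 0 < d) (hV : IsAdmissible V)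
    (hη : IsSymmetricIID P η) (ε : ℝ≥0) (L : ℕ) :
    ∫⁻ ω, ENNReal.ofReal (-overlap V ε (box d L) fun i => η i ω) ∂P ≠ ∞ := by
  have hint := (hη.integrable_sum_mul (box d L) (magnetization V ε (box d L) 0)).neg
  refine ((lintegral_mono fun ω => ENNReal.ofReal_le_ofReal ?_).trans_lt
    hint.lintegral_lt_top).ne
  simp only [Pi.neg_apply]
  have := sum_mul_magnetization_zero_le_overlap hd hV ε L fun i => η i ω
  simp only [mul_comm (η _ ω)] at this
  linarith

theorem le_extExpectation_overlap (hd : 0 < d) (hV : IsAdmissible V) (hη : IsSymmetricIID P η)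
    (ε : ℝ≥0) {A : ℝ}
    (hZ : ∀ L : ℕ, partition V ε (box d L) 0 ≤ (A * (2 + ε)) ^ (box d L).card)
    {M R : ℕ} {f : Site d → ℝ} (hf : ∀ i, i ∉ box d R → f i = 0)
    (hD : ∀ S : Finset (Site d), ∑ i ∈ S, ∑ j ∈ neighbours i, (f i - f j) ^ 2 ≤ 8 * d * f 0) :
    (((∫ ω, η 0 ω ^ 2 ∂P) / 2 * (box d M).card * f 0 - (box d (M + R + 1)).card *
        (|V 0| / 2 + 1 / 4 + Real.log (A * (2 + ε))) : ℝ) : EReal) ≤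
      extExpectation P fun ω => overlap V ε (box d (M + R + 1)) fun i => η i ω := by
  obtain ⟨m, Y, hY, hmY, hYint⟩ := exists_energy_le (M := M) hd hV hη hf hD
  have hlogZ : Real.log (partition V ε (box d (M + R + 1)) 0) ≤
      (box d (M + R + 1)).card * Real.log (A * (2 + ε)) := by
    rw [← Real.log_pow]
    exact Real.log_le_log (partition_pos hd hV ε _ 0) (hZ _)
  let c : ℝ := 1 / 4 * (box d (M + R + 1)).card +
    (box d (M + R + 1)).card * Real.log (A * (2 + ε))
  let W : Ω → ℝ := fun ω => -Y ω - c
  have hW : Integrable W P := hY.neg.sub (integrable_const _)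
  have hWint : ∫ ω, W ω ∂P = -∫ ω, Y ω ∂P - c := by
    simp only [W]
    rw [integral_sub (by exact hY.neg) (integrable_const _), integral_neg]
    simp
  calc _ ≤ ((∫ ω, W ω ∂P : ℝ) : EReal) := by
        rw [EReal.coe_le_coe_iff, hWint]
        simp only [c]
        linarith
    _ = extExpectation P W := (extExpectation_of_integrable hW).symm
    _ ≤ _ := extExpectation_mono fun ω => by
        have h1 := log_partition_sub_le_overlap hd hV ε (M + R + 1) fun i => η i ω
        have h2 := neg_energy_le_log_partition hd hV ε (M + R + 1) (fun i => η i ω) (m ω)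
        have h3 := hmY ω
        simp only [W, c]
        linarith

theorem tendsto_card_box_sub_div (d K : ℕ) :
    Tendsto (fun L : ℕ => ((box d (L - K)).card : ℝ) / (L : ℝ) ^ d) atTop (𝓝 (2 ^ d)) := by
  have h1 : Tendsto (fun L : ℕ => 2 + (1 - 2 * (K : ℝ)) / (L : ℝ)) atTop (𝓝 (2 + 0)) :=
    tendsto_const_nhds.add (tendsto_const_div_atTop_nhds_zero_nat _)
  rw [add_zero] at h1
  refine (h1.pow d).congr' ?_
  filter_upwards [eventually_ge_atTop (K + 1)] with L hL
  rw [card_box, Nat.cast_pow, ← div_pow]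
  congr 1
  have : (L : ℝ) ≠ 0 := by
    have : 0 < L := by omega
    positivity
  push_cast [Nat.cast_sub (by omega : K ≤ L)]
  field_simp
  ring

theorem le_liminf_extExpectation_overlap (hd : 0 < d) (hV : IsAdmissible V)
    (hη : IsSymmetricIID P η) {g : Site d → ℝ} (hg : IsGreenFunction g) (ε : ℝ≥0) {A : ℝ}
    (hZ : ∀ L : ℕ, partition V ε (box d L) 0 ≤ (A * (2 + ε)) ^ (box d L).card) :
    (((∫ ω, η 0 ω ^ 2 ∂P) * g 0 / 2 -
        (|V 0| / 2 + 1 / 4 + Real.log (A * (2 + ε))) : ℝ) : EReal) ≤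
      liminf (fun L : ℕ => ((1 / (L : ℝ) ^ d : ℝ) : EReal) *
        extExpectation P fun ω => overlap V ε (box d L) fun i => η i ω) atTop := by
  set σ := ∫ ω, η 0 ω ^ 2 ∂P with hσ
  have hσ0 : 0 ≤ σ := integral_nonneg fun _ => sq_nonneg _
  set ℓ := |V 0| / 2 + 1 / 4 + Real.log (A * (2 + ε)) with hℓ
  have hnn : ∀ L : ℕ, (0 : EReal) ≤ ((1 / (L : ℝ) ^ d : ℝ) : EReal) := fun L => by
    exact_mod_cast (by positivity : (0 : ℝ) ≤ 1 / (L : ℝ) ^ d)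
  rcases le_or_gt (σ * g 0 / 2 - ℓ) 0 with hT | hT
  · refine le_liminf_of_le (by isBoundedDefault) (Eventually.of_forall fun L => ?_)
    exact le_trans (by exact_mod_cast hT)
      (mul_nonneg (hnn L) (extExpectation_overlap_nonneg hd hV hη ε L))
  set T := σ * g 0 / 2 - ℓ with hTdef
  have hg0 := hg.pos hd
  obtain ⟨δ, hδ, hδg, hδT⟩ : ∃ δ, 0 < δ ∧ δ < g 0 ∧ σ / 2 * δ < T / 2 := by
    refine ⟨min (g 0 / 2) (T / (2 * (σ + 1))), by positivity,
      (min_le_left _ _).trans_lt (by linarith), ?_⟩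
    calc σ / 2 * min (g 0 / 2) (T / (2 * (σ + 1))) ≤ σ / 2 * (T / (2 * (σ + 1))) := by
          gcongr; exact min_le_right _ _
      _ < T / 2 := by
          rw [div_mul_div_comm, div_lt_div_iff₀ (by positivity) (by positivity)]
          nlinarith
  obtain ⟨R, f, hf, hf0, hD⟩ := hg.exists_truncation hd hδ hδg
  have hlim : Tendsto (fun L : ℕ => σ / 2 * f 0 * (((box d (L - (R + 1))).card : ℝ) / (L : ℝ) ^ d) -
      ℓ * (((box d (L - 0)).card : ℝ) / (L : ℝ) ^ d)) atTop
      (𝓝 (σ / 2 * f 0 * 2 ^ d - ℓ * 2 ^ d)) :=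
    ((tendsto_card_box_sub_div d (R + 1)).const_mul _).sub
      ((tendsto_card_box_sub_div d 0).const_mul _)
  have hgt : T < σ / 2 * f 0 * 2 ^ d - ℓ * 2 ^ d := by
    have h2 : (2 : ℝ) ≤ 2 ^ d := le_self_pow₀ (by norm_num) (by omega)
    have h3 : T / 2 < σ / 2 * f 0 - ℓ := by rw [hf0]; linarith
    have h4 : 2 * (σ / 2 * f 0 - ℓ) ≤ 2 ^ d * (σ / 2 * f 0 - ℓ) := by
      gcongr
      linarith
    linarith
  refine le_liminf_of_le (by isBoundedDefault) ?_
  filter_upwards [hlim.eventually (lt_mem_nhds hgt), eventually_ge_atTop (R + 1)] with L hL hLR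
  have hb := le_extExpectation_overlap (M := L - (R + 1)) hd hV hη ε hZ hf hD
  have hLeq : L - (R + 1) + R + 1 = L := by omega
  rw [hLeq] at hb
  refine le_trans ?_ (mul_le_mul_of_nonneg_left hb (hnn L))
  rw [← EReal.coe_mul, EReal.coe_le_coe_iff]
  rw [Nat.sub_zero] at hL
  refine hL.le.trans (le_of_eq ?_)
  ring

end Overlap

end PinnedInterface

theorem theorem2 (d : ℕ) (hd : 3 ≤ d) (V : ℝ → ℝ) (hV : IsAdmissible V) :
    -- the finite-volume Gibbs measures and the local magnetizations are well defined
    (∀ (ε : ℝ≥0) (L : ℕ) (η : Site d → ℝ),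
      IsProbabilityMeasure (gibbs V ε (box d L) η) ∧
      ∀ i ∈ box d L, Integrable (fun φ => zeroExtend φ i) (gibbs V ε (box d L) η)) ∧
    -- the infinite-volume Green's function exists and is unique
    (∃! g : Site d → ℝ, IsGreenFunction g) ∧
    ∀ g : Site d → ℝ, IsGreenFunction g →
      0 < g 0 ∧
      ∃ B₁ B₂ : ℝ, 0 < B₁ ∧ 0 < B₂ ∧
        ∀ (ε : ℝ≥0) (Ω : Type*) [MeasurableSpace Ω] (P : Measure Ω) [IsProbabilityMeasure P]
          (η : Site d → Ω → ℝ), IsSymmetricIID P η →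
          -- the disorder average of the overlap is well defined in `(-∞, ∞]`
          (∀ L : ℕ,
            AEMeasurable (fun ω => overlap V ε (box d L) (fun i => η i ω)) P ∧
            ∫⁻ ω, ENNReal.ofReal (- overlap V ε (box d L) (fun i => η i ω)) ∂P ≠ ∞) ∧
          -- the lower bound for the disorder average of the overlap
          (((∫ ω, (η 0 ω) ^ 2 ∂P) * g 0 / 2 - Real.log (B₁ + B₂ * ε) : ℝ) : EReal) ≤
            liminf (fun L : ℕ => ((1 / (L : ℝ) ^ d : ℝ) : EReal) *
              extExpectation P (fun ω => overlap V ε (box d L) (fun i => η i ω))) atTop ∧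
          -- the same bound, site by site, when the expectations at the single sites exist
          ((∀ᶠ L : ℕ in atTop, ∀ i ∈ box d L,
              Integrable (fun ω =>
                η i ω * magnetization V ε (box d L) (fun j => η j ω) i) P) →
            (((∫ ω, (η 0 ω) ^ 2 ∂P) * g 0 / 2 - Real.log (B₁ + B₂ * ε) : ℝ) : EReal) ≤
              liminf (fun L : ℕ => ((1 / (L : ℝ) ^ d * ∑ i ∈ box d L,
                ∫ ω, η i ω * magnetization V ε (box d L) (fun j => η j ω) i ∂P : ℝ) : EReal))
                atTop) := by
  have hd0 : 0 < d := by omega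
  refine ⟨fun ε L η => ⟨isProbabilityMeasure_gibbs hd0 hV ε L η,
      fun i hi => integrable_zeroExtend_gibbs hd0 hV ε L η hi⟩,
    ⟨green d, isGreenFunction_green hd, fun g hg => hg.unique hd0 (isGreenFunction_green hd)⟩,
    fun g hg => ⟨hg.pos hd0, ?_⟩⟩
  obtain ⟨A, hA, hZ⟩ := exists_partition_zero_le hd0 hV
  set c := Real.exp (|V 0| / 2 + 1 / 4) with hc
  refine ⟨c * A * 2, c * A, by positivity, by positivity, fun ε Ω _ P _ η hη => ?_⟩
  have hlog : Real.log (c * A * 2 + c * A * ε) =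
      |V 0| / 2 + 1 / 4 + Real.log (A * (2 + ε)) := by
    have e : c * A * 2 + c * A * ε = c * (A * (2 + ε)) := by ring
    rw [e, Real.log_mul (by positivity) (by positivity), hc, Real.log_exp]
  have hmain := le_liminf_extExpectation_overlap hd0 hV hη hg ε (hZ ε)
  rw [hlog]
  refine ⟨fun L => ⟨(measurable_overlap hV.continuous ε _).comp_aemeasurable hη.aemeasurable,
    lintegral_neg_overlap_ne_top hd0 hV hη ε L⟩, hmain, fun hint => hmain.trans_eq ?_⟩
  refine liminf_congr ?_
  filter_upwards [hint] with L hL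
  rw [extExpectation_overlap_eq_sum ε hL, ← EReal.coe_mul]
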